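/- Fix $\Delta>0$, $\alpha_B,\alpha_E>0$, $\lambda_B,\lambda_E>0$ with $\alpha_B=\alpha_E$ and $\lambda_B/\alpha_B\le\lambda_E/\alpha_E$. In the discrete-time Poisson wiretap channel with slots of $\Delta$ seconds, an intensity $x\ge 0$ sent in a slot produces at the legitimate receiver a Poisson variable $Y$ with mean $(\alpha_Bx+\lambda_B)\Delta$ and at the eavesdropper a Poisson variable $Z$ with mean $(\alpha_Ex+\lambda_E)\Delta$; different slots are independent given the inputs. A code of block length $n$ with $M$ messages consists of a message $W$ uniform on $M$ values, a stochastic encoder sending $W$ to a random vector $X^n\in[0,\infty)^n$, and a decoder $g_n:\mathbb N^n\to\{1,\dots,M\}$ of the legitimate receiver; it satisfies the average-intensity constraint $\mathcal E$ if $\frac1n\sum_{i=1}^n\mathbb E[X_i]\le\mathcal E$ (there is no peak-intensity constraint). A rate $R\ge 0$ (in nats per second) is perfectly secure under the constraint $\mathcal E$ if there are codes of block length $n$ with $\lceil e^{n\Delta R}\rceil$ messages, $n\in\mathbb N$, satisfying the constraint, such that $\Pr[g_n(Y^n)\ne W]\to 0$ and $\frac1n I(W;Z^n)\to 0$ as $n\to\infty$.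 The secrecy capacity $C_S(\mathcal E)$ is the supremum of the perfectly secure rates. Then $$\lim_{\mathcal E\to 0^+}\frac{C_S(\mathcal E)}{\mathcal E}=\alpha_B\log\frac{\lambda_E}{\lambda_B},$$ where $\log$ is the natural logarithm (in particular $C_S(\mathcal E)$ is finite for all sufficiently small $\mathcal E>0$). -/

import Mathlib

open MeasureTheory ProbabilityTheory InformationTheory Filter Topology
open scoped NNReal ENNReal

namespace PoissonWiretap

noncomputable section

/-- A map into the probability measures on a countable discrete space is measurable as soon as the
masses of all points are measurable. -/
theorem measurable_of_singletons {α β : Type*} [MeasurableSpace α] [MeasurableSpace β]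
    [Countable β] [MeasurableSingletonClass β] (f : α → Measure β)
    (h : ∀ b, Measurable fun a => f a {b}) : Measurable f := by
  refine Measure.measurable_of_measurable_coe _ fun s _ => ?_
  simp_rw [← fun a => (f a).tsum_indicator_apply_singleton s (Set.to_countable s).measurableSet]
  refine Measurable.tsum fun b => ?_
  by_cases hb : b ∈ s
  · simpa [hb] using h b
  · simp [hb]

theorem measurable_poissonMeasure : Measurable poissonMeasure := by
  refine measurable_of_singletons _ fun k => ?_
  simp_rw [poissonMeasure_singleton]
  fun_prop

/-- One use of the photon-counting channel with gain `α`, dark current `lam` and slot duration `Δ`: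
given the intensity `x`, the output is Poisson with mean `(α * x + lam) * Δ`. -/
def channel (α lam Δ : ℝ≥0) : Kernel ℝ≥0 ℕ where
  toFun x := poissonMeasure ((α * x + lam) * Δ)
  measurable' := measurable_poissonMeasure.comp (by fun_prop)

instance (α lam Δ : ℝ≥0) : IsMarkovKernel (channel α lam Δ) :=
  ⟨fun x => inferInstanceAs (IsProbabilityMeasure (poissonMeasure ((α * x + lam) * Δ)))⟩

/-- `n` memoryless uses of the channel: given `x₁, …, xₙ`, the outputs are independent and the
`i`-th one has the law `channel α lam Δ xᵢ`. -/
def channelN (α lam Δ : ℝ≥0) (n : ℕ) : Kernel (Fin n → ℝ≥0) (Fin n → ℕ) where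
  toFun x := Measure.pi fun i => channel α lam Δ (x i)
  measurable' := by
    refine measurable_of_singletons _ fun k => ?_
    simp_rw [Measure.pi_singleton]
    exact Finset.measurable_prod _ fun i _ =>
      ((channel α lam Δ).measurable_coe (measurableSet_singleton _)).comp (measurable_pi_apply i)

instance (α lam Δ : ℝ≥0) (n : ℕ) : IsMarkovKernel (channelN α lam Δ n) :=
  ⟨fun x => inferInstanceAs (IsProbabilityMeasure (Measure.pi fun i => channel α lam Δ (x i)))⟩

/-- Mutual information, in nats, of two random variables with joint law `μ`. -/
def mutualInfo {β γ : Type*} [MeasurableSpace β] [MeasurableSpace γ]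
    (μ : Measure (β × γ)) : ℝ≥0∞ :=
  klDiv μ (μ.fst.prod μ.snd)

/-- A wiretap code of block length `n` for `M` messages: a stochastic encoder, which sends every
message to a random vector of `n` nonnegative intensities, and a decoder for the legitimate
receiver. -/
structure Code (n M : ℕ) where
  encoder : Kernel (Fin M) (Fin n → ℝ≥0)
  isMarkovKernel : IsMarkovKernel encoder
  decoder : (Fin n → ℕ) → Fin M

attribute [instance] Code.isMarkovKernel

namespace Code

variable {n M : ℕ}

/-- The law of the message: uniform on the `M` messages. -/
def messageLaw (M : ℕ) : Measure (Fin M) := uniformOn Set.univ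

/-- The law of the transmitted vector of intensities. -/
def inputLaw (c : Code n M) : Measure (Fin n → ℝ≥0) := (messageLaw M).bind c.encoder

/-- The joint law of the message and of the output vector of a channel with gain `α`, dark
current `lam` and slot duration `Δ`. -/
def jointLaw (c : Code n M) (α lam Δ : ℝ≥0) : Measure (Fin M × (Fin n → ℕ)) :=
  (messageLaw M) ⊗ₘ (channelN α lam Δ n ∘ₖ c.encoder)

/-- The average-intensity constraint `(1 / n) ∑ᵢ 𝔼[Xᵢ] ≤ E`. -/
def MeetsAverage (c : Code n M) (E : ℝ≥0) : Prop :=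
  ∑ i, ∫⁻ x, (x i : ℝ≥0∞) ∂c.inputLaw ≤ n * E

/-- The probability that the decoder, fed with the output of the channel, errs. -/
def errorProb (c : Code n M) (α lam Δ : ℝ≥0) : ℝ≥0∞ :=
  c.jointLaw α lam Δ {p | c.decoder p.2 ≠ p.1}

/-- The information, in nats, that the channel output gives about the message. -/
def leakage (c : Code n M) (α lam Δ : ℝ≥0) : ℝ≥0∞ :=
  mutualInfo (c.jointLaw α lam Δ)

end Code

/-- `R`, in nats per second, is a perfectly secure rate under the average-intensity constraint `E`:
there are codes, one for each block length `n`, with `⌈exp (n * Δ * R)⌉` messages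
(`n` slots last `n * Δ` seconds), whose error probability at the legitimate receiver (`αB`, `lamB`)
and whose leakage per slot to the eavesdropper (`αE`, `lamE`) tend to zero. -/
def IsSecureRate (αB lamB αE lamE Δ E R : ℝ≥0) : Prop :=
  ∃ c : ∀ n : ℕ, Code n ⌈Real.exp (n * Δ * R)⌉₊,
    (∀ n, (c n).MeetsAverage E) ∧
    Tendsto (fun n => (c n).errorProb αB lamB Δ) atTop (𝓝 0) ∧
    Tendsto (fun n => (c n).leakage αE lamE Δ / n) atTop (𝓝 0)

/-- The secrecy capacity, in nats per second, under the average-intensity constraint `E` (and no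
peak-intensity constraint): the supremum of the perfectly secure rates. -/
def secrecyCapacity (αB lamB αE lamE Δ E : ℝ≥0) : ℝ≥0∞ :=
  ⨆ (R : ℝ≥0) (_ : IsSecureRate αB lamB αE lamE Δ E R), (R : ℝ≥0∞)

end

end PoissonWiretap

/-!
Converse. The counts of the eavesdropper are those of the receiver plus independent dark counts.
Divide the joint law of the message and of the counts by the information density of the
eavesdropper's total and by the conditional density of the receiver's counts given that total: the
message becomes independent of the counts, so that a guess succeeds with probability `1 / M` only.
Jensen's inequality bounds `(1 - errorProb) * log M` by `log 2`, plus the leakage, plus the mean of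
the logarithm of the conditional density. Since `t * log t` is convex, an intensity `x` contributes
at most `α x log (λE / λB) Δ` to that mean.

Achievability. In a random on-off codebook whose messages are spread over many codewords, the error
probability and the leakage are both controlled by moments of order close to zero of an information
density: the former by Gallager's bound, the latter by soft covering. The average intensity tends
to zero through the duty cycle `p` of the input, at a fixed intensity `A` of the on state. The gain
is then linear in `p`; as the order of the moments tends to zero its slope tends to a difference of
Poisson divergences, and dividing by `A → ∞` leaves `α log (λE / λB)`.
-/

namespace PoissonWiretap

section Information

section General

variable {α β : Type*} [MeasurableSpace α] [MeasurableSpace β]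

theorem klDiv_map_swap (μ ν : Measure (α × β)) [IsFiniteMeasure μ] [IsFiniteMeasure ν] :
    klDiv (μ.map Prod.swap) (ν.map Prod.swap) = klDiv μ ν := by
  refine le_antisymm (klDiv_map_le μ ν measurable_swap) ?_
  simpa [Measure.map_map measurable_swap measurable_swap] using
    klDiv_map_le (μ.map Prod.swap) (ν.map Prod.swap) measurable_swap

/-- By the chain rule, replacing the second marginal by another law `q` costs the divergence
between the two. -/
theorem mutualInfo_le_klDiv_prod [StandardBorelSpace α] [Nonempty α] (π : Measure (α × β))
    [IsProbabilityMeasure π] (q : Measure β) [IsProbabilityMeasure q] :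
    mutualInfo π ≤ klDiv π (π.fst.prod q) := by
  have hπ : (π.map Prod.swap).fst ⊗ₘ (π.map Prod.swap).condKernel = π.map Prod.swap :=
    Measure.disintegrate _ _
  have hchain := klDiv_compProd_eq_add (π.map Prod.swap).fst q (π.map Prod.swap).condKernel
    (Kernel.const β π.fst)
  rw [hπ, Measure.compProd_const, Measure.compProd_const, Measure.fst_map_swap] at hchain
  rw [mutualInfo, ← klDiv_map_swap π (π.fst.prod π.snd), ← klDiv_map_swap π (π.fst.prod q),
    Measure.prod_swap, Measure.prod_swap, hchain]
  exact le_add_self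

theorem mul_klFun_add_le_mul_rpow_add {ρ s : ℝ} (hs : 0 ≤ s) :
    ρ * klFun s + s + ρ * s ≤ s * s ^ ρ + ρ := by
  rcases hs.eq_or_lt with rfl | hs
  · simp [klFun_zero]
  have hlog : ρ * Real.log s ≤ s ^ ρ - 1 := by
    rw [← Real.log_rpow hs]
    exact Real.log_le_sub_one_of_pos (by positivity)
  rw [klFun_apply]
  linarith [mul_le_mul_of_nonneg_left hlog hs.le]

theorem ofReal_mul_klDiv_add_one_le {μ ν : Measure α} [IsProbabilityMeasure μ]
    [IsProbabilityMeasure ν] (hμν : μ ≪ ν) {ρ : ℝ} (hρ : 0 ≤ ρ) :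
    ENNReal.ofReal ρ * klDiv μ ν + 1 ≤ ∫⁻ x, μ.rnDeriv ν x ^ ρ ∂μ := by
  have hpt : ∀ᵐ x ∂ν, ENNReal.ofReal ρ * ENNReal.ofReal (klFun (μ.rnDeriv ν x).toReal)
      + μ.rnDeriv ν x + ENNReal.ofReal ρ * μ.rnDeriv ν x
      ≤ μ.rnDeriv ν x * μ.rnDeriv ν x ^ ρ + ENNReal.ofReal ρ := by
    filter_upwards [μ.rnDeriv_lt_top ν] with x hx
    lift μ.rnDeriv ν x to ℝ≥0 using hx.ne with s
    have hkl := klFun_nonneg s.coe_nonneg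
    rw [← ENNReal.coe_rpow_of_nonneg _ hρ]
    simp only [← ENNReal.ofReal_coe_nnreal, NNReal.coe_rpow]
    rw [ENNReal.toReal_ofReal s.coe_nonneg, ← ENNReal.ofReal_mul hρ, ← ENNReal.ofReal_mul hρ,
      ← ENNReal.ofReal_mul s.coe_nonneg, ← ENNReal.ofReal_add (by positivity) (by positivity),
      ← ENNReal.ofReal_add (by positivity) (by positivity),
      ← ENNReal.ofReal_add (by positivity) hρ]
    exact ENNReal.ofReal_le_ofReal (mul_klFun_add_le_mul_rpow_add s.coe_nonneg)
  have hint := lintegral_mono_ae hpt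
  have hone : ∫⁻ x, μ.rnDeriv ν x ∂ν = 1 := by rw [Measure.lintegral_rnDeriv hμν, measure_univ]
  have hkl : Measurable fun x => ENNReal.ofReal (klFun (μ.rnDeriv ν x).toReal) := by fun_prop
  rw [lintegral_add_left (by fun_prop), lintegral_add_left (by fun_prop),
    lintegral_add_right _ measurable_const, lintegral_const_mul _ hkl,
    lintegral_const_mul _ (by fun_prop), ← klDiv_eq_lintegral_klFun_of_ac hμν, hone,
    lintegral_const, measure_univ, lintegral_rnDeriv_mul hμν (by fun_prop)] at hint
  exact (ENNReal.add_le_add_iff_right (by finiteness)).1 hint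

theorem integral_le_log_of_lintegral_exp_le {μ : Measure α} [IsProbabilityMeasure μ] {f : α → ℝ}
    (hf : Integrable f μ) {c : ℝ} (hc : 0 < c)
    (h : ∫⁻ x, ENNReal.ofReal (Real.exp (f x)) ∂μ ≤ ENNReal.ofReal c) :
    ∫ x, f x ∂μ ≤ Real.log c := by
  have hmeas : AEStronglyMeasurable (fun x => Real.exp (f x)) μ :=
    Real.continuous_exp.comp_aestronglyMeasurable hf.1
  have hint : Integrable (fun x => Real.exp (f x)) μ :=
    (lintegral_ofReal_ne_top_iff_integrable hmeas (ae_of_all _ fun _ => Real.exp_nonneg _)).1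
      (ne_top_of_le_ne_top ENNReal.ofReal_ne_top h)
  rw [Real.le_log_iff_exp_le hc]
  calc Real.exp (∫ x, f x ∂μ) ≤ ∫ x, Real.exp (f x) ∂μ :=
        convexOn_exp.map_integral_le Real.continuous_exp.continuousOn isClosed_univ (by simp)
          hf hint
    _ ≤ c := by
        rw [← ENNReal.ofReal_le_ofReal_iff hc.le,
          ofReal_integral_eq_lintegral_ofReal hint (ae_of_all _ fun _ => Real.exp_nonneg _)]
        exact h

theorem mutualInfo_compProd (μ : Measure α) [SFinite μ] (κ : Kernel α β) [IsMarkovKernel κ] :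
    mutualInfo (μ ⊗ₘ κ) = klDiv (μ ⊗ₘ κ) (μ.prod (κ ∘ₘ μ)) := by
  rw [mutualInfo, Measure.fst_compProd, Measure.snd_compProd]

theorem compProd_singleton [MeasurableSingletonClass α] [MeasurableSingletonClass β]
    (μ : Measure α) [SFinite μ] (κ : Kernel α β) [IsSFiniteKernel κ] (a : α) (b : β) :
    (μ ⊗ₘ κ) {(a, b)} = μ {a} * κ a {b} := by
  rw [← Set.singleton_prod_singleton,
    Measure.compProd_apply_prod (measurableSet_singleton a) (measurableSet_singleton b),
    lintegral_singleton, mul_comm]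

end General

section Discrete

variable {α β : Type*} [MeasurableSpace α] [MeasurableSpace β] [Countable α] [Countable β]
  [MeasurableSingletonClass α] [MeasurableSingletonClass β]

theorem compProd_eq_withDensity_prod (μ : Measure α) [SFinite μ] (κ : Kernel α β)
    [IsSFiniteKernel κ] (q : Measure β) [IsFiniteMeasure q] (hq : ∀ b, q {b} ≠ 0) :
    μ ⊗ₘ κ = (μ.prod q).withDensity fun p => κ p.1 {p.2} / q {p.2} := by
  refine Measure.ext_of_singleton fun ⟨a, b⟩ => ?_
  rw [compProd_singleton, withDensity_apply _ (measurableSet_singleton _), lintegral_singleton,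
    ← Set.singleton_prod_singleton, Measure.prod_prod, mul_left_comm,
    ENNReal.div_mul_cancel (hq b) (measure_ne_top q {b})]

theorem compProd_absolutelyContinuous_prod (μ : Measure α) [SFinite μ] (κ : Kernel α β)
    [IsSFiniteKernel κ] (q : Measure β) [IsFiniteMeasure q] (hq : ∀ b, q {b} ≠ 0) :
    μ ⊗ₘ κ ≪ μ.prod q := by
  rw [compProd_eq_withDensity_prod μ κ q hq]
  exact withDensity_absolutelyContinuous _ _

theorem rnDeriv_compProd_prod (μ : Measure α) [IsFiniteMeasure μ] (κ : Kernel α β)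
    [IsSFiniteKernel κ] (q : Measure β) [IsFiniteMeasure q] (hq : ∀ b, q {b} ≠ 0) :
    (μ ⊗ₘ κ).rnDeriv (μ.prod q) =ᵐ[μ ⊗ₘ κ] fun p => κ p.1 {p.2} / q {p.2} := by
  refine (compProd_absolutelyContinuous_prod μ κ q hq).ae_le ?_
  nth_rewrite 1 [compProd_eq_withDensity_prod μ κ q hq]
  exact Measure.rnDeriv_withDensity _ .of_discrete

theorem ofReal_mul_mutualInfo_add_one_le [Nonempty α] (μ : Measure α) [IsProbabilityMeasure μ]
    (κ : Kernel α β) [IsMarkovKernel κ] (q : Measure β) [IsProbabilityMeasure q]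
    (hq : ∀ b, q {b} ≠ 0) {ρ : ℝ} (hρ : 0 ≤ ρ) :
    ENNReal.ofReal ρ * mutualInfo (μ ⊗ₘ κ) + 1
      ≤ ∫⁻ p, (κ p.1 {p.2} / q {p.2}) ^ ρ ∂(μ ⊗ₘ κ) :=
  calc ENNReal.ofReal ρ * mutualInfo (μ ⊗ₘ κ) + 1
      ≤ ENNReal.ofReal ρ * klDiv (μ ⊗ₘ κ) (μ.prod q) + 1 := by
        gcongr
        simpa only [Measure.fst_compProd] using mutualInfo_le_klDiv_prod (μ ⊗ₘ κ) q
    _ ≤ ∫⁻ p, (μ ⊗ₘ κ).rnDeriv (μ.prod q) p ^ ρ ∂(μ ⊗ₘ κ) :=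
        ofReal_mul_klDiv_add_one_le (compProd_absolutelyContinuous_prod μ κ q hq) hρ
    _ = ∫⁻ p, (κ p.1 {p.2} / q {p.2}) ^ ρ ∂(μ ⊗ₘ κ) := by
        refine lintegral_congr_ae ?_
        filter_upwards [rnDeriv_compProd_prod μ κ q hq] with p hp
        rw [hp]

/-- The density of the joint law `μ ⊗ₘ κ` of the input and the output of a discrete channel with
respect to the product of its marginals; its logarithm has the mutual information as its mean. -/
noncomputable def infoDensity (μ : Measure α) (κ : Kernel α β) (p : α × β) : ℝ≥0∞ :=
  κ p.1 {p.2} / (κ ∘ₘ μ) {p.2}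

variable (μ : Measure α) [IsProbabilityMeasure μ] (κ : Kernel α β) [IsMarkovKernel κ]

theorem llr_compProd_ae_eq (h : ∀ b, (κ ∘ₘ μ) {b} ≠ 0) :
    llr (μ ⊗ₘ κ) (μ.prod (κ ∘ₘ μ)) =ᵐ[μ ⊗ₘ κ] fun p => Real.log (infoDensity μ κ p).toReal := by
  filter_upwards [rnDeriv_compProd_prod μ κ (κ ∘ₘ μ) h] with p hp
  rw [llr, hp, infoDensity]

theorem integrable_log_infoDensity (h : ∀ b, (κ ∘ₘ μ) {b} ≠ 0)
    (hfin : mutualInfo (μ ⊗ₘ κ) ≠ ∞) :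
    Integrable (fun p => Real.log (infoDensity μ κ p).toReal) (μ ⊗ₘ κ) := by
  rw [mutualInfo_compProd, klDiv_ne_top_iff] at hfin
  exact hfin.2.congr (llr_compProd_ae_eq μ κ h)

theorem integral_log_infoDensity (h : ∀ b, (κ ∘ₘ μ) {b} ≠ 0) :
    ∫ p, Real.log (infoDensity μ κ p).toReal ∂(μ ⊗ₘ κ) = (mutualInfo (μ ⊗ₘ κ)).toReal := by
  rw [mutualInfo_compProd, toReal_klDiv_of_measure_eq
    (compProd_absolutelyContinuous_prod μ κ (κ ∘ₘ μ) h) (by simp)]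
  exact integral_congr_ae (llr_compProd_ae_eq μ κ h).symm

end Discrete

end Information

section Converse

variable {W X O Z : Type*} [MeasurableSpace W] [MeasurableSpace X] [MeasurableSpace O]
  [MeasurableSpace Z]

theorem comp_singleton_ne_zero [MeasurableSingletonClass O] (μ : Measure X) [NeZero μ]
    (κ : Kernel X O) {o : O} (h : ∀ x, κ x {o} ≠ 0) : (κ ∘ₘ μ) {o} ≠ 0 := by
  rw [Measure.bind_apply (measurableSet_singleton o) κ.aemeasurable, ne_eq,
    lintegral_eq_zero_iff (κ.measurable_coe (measurableSet_singleton o))]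
  intro hzero
  obtain ⟨x, hx⟩ := hzero.exists
  exact h x hx

/-- The joint law of a message of law `μ`, of its random encoding by `ξ` and of the output of the
channel `K` fed with the latter. -/
noncomputable def fullLaw (μ : Measure W) (ξ : Kernel W X) (K : Kernel X O) :
    Measure ((W × X) × O) :=
  (μ ⊗ₘ ξ) ⊗ₘ K.prodMkLeft W

section FullLaw

variable (μ : Measure W) [IsProbabilityMeasure μ] (ξ : Kernel W X) [IsMarkovKernel ξ]
  (K : Kernel X O) [IsMarkovKernel K]

instance : IsProbabilityMeasure (fullLaw μ ξ K) := by
  rw [fullLaw]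
  infer_instance

theorem lintegral_fullLaw {f : (W × X) × O → ℝ≥0∞} (hf : Measurable f) :
    ∫⁻ p, f p ∂fullLaw μ ξ K = ∫⁻ w, ∫⁻ x, ∫⁻ o, f ((w, x), o) ∂K x ∂ξ w ∂μ := by
  rw [fullLaw, Measure.lintegral_compProd hf,
    Measure.lintegral_compProd hf.lintegral_kernel_prod_right']
  rfl

theorem map_fullLaw_message_output {ζ : O → Z} (hζ : Measurable ζ) :
    (fullLaw μ ξ K).map (fun p => (p.1.1, ζ p.2)) = μ ⊗ₘ (K.map ζ ∘ₖ ξ) := by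
  have hm : Measurable fun p : (W × X) × O => (p.1.1, ζ p.2) := by fun_prop
  have := Kernel.IsMarkovKernel.map K hζ
  refine Measure.ext_of_lintegral _ fun f hf => ?_
  rw [lintegral_map hf hm, lintegral_fullLaw μ ξ K (f := fun p => f (p.1.1, ζ p.2)) (by fun_prop),
    Measure.lintegral_compProd hf]
  refine lintegral_congr fun w => ?_
  rw [Kernel.lintegral_comp _ _ _ (by fun_prop)]
  refine lintegral_congr fun x => ?_
  rw [Kernel.lintegral_map _ hζ _ (by fun_prop)]

theorem map_fullLaw_input_output :
    (fullLaw μ ξ K).map (fun p => (p.1.2, p.2)) = (ξ ∘ₘ μ) ⊗ₘ K := by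
  have hm : Measurable fun p : (W × X) × O => (p.1.2, p.2) := by fun_prop
  refine Measure.ext_of_lintegral _ fun f hf => ?_
  rw [lintegral_map hf hm, lintegral_fullLaw μ ξ K (f := fun p => f (p.1.2, p.2)) (by fun_prop),
    Measure.lintegral_compProd hf,
    Measure.lintegral_bind ξ.aemeasurable hf.lintegral_kernel_prod_right'.aemeasurable]

end FullLaw

theorem lintegral_mul_inv_infoDensity [MeasurableSingletonClass Z] (μ : Measure W)
    [IsProbabilityMeasure μ] (ξ : Kernel W X) [IsMarkovKernel ξ] (KZ : Kernel X Z)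
    [IsMarkovKernel KZ] (hKZ : ∀ x z, KZ x {z} ≠ 0) (w : W) (z : Z) :
    (infoDensity μ (KZ ∘ₖ ξ) (w, z))⁻¹ * ∫⁻ x, KZ x {z} ∂ξ w = ((KZ ∘ₖ ξ) ∘ₘ μ) {z} := by
  have hpos : (KZ ∘ₖ ξ) w {z} ≠ 0 := by
    rw [Kernel.comp_apply]
    exact comp_singleton_ne_zero _ _ fun x => hKZ x z
  rw [← Kernel.comp_apply' _ _ _ (measurableSet_singleton z), infoDensity,
    ENNReal.inv_div (.inl (measure_ne_top _ _)) (.inr hpos),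
    ENNReal.div_mul_cancel hpos (measure_ne_top _ _)]

variable [Countable W] [MeasurableSingletonClass W] [Countable O] [MeasurableSingletonClass O]
  [Countable Z] [MeasurableSingletonClass Z]

theorem isProbabilityMeasure_withDensity_comp (ν : Measure O) [IsProbabilityMeasure ν] (ζ : O → Z)
    (hν : ∀ z, ν.map ζ {z} ≠ 0) (q : Measure Z) [IsProbabilityMeasure q] :
    IsProbabilityMeasure (ν.withDensity fun o => q {ζ o} / ν.map ζ {ζ o}) := by
  have hζ : Measurable ζ := .of_discrete
  have := Measure.isProbabilityMeasure_map (μ := ν) hζ.aemeasurable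
  have hmap : ∀ z, q {z} / ν.map ζ {z} * ν.map ζ {z} = q {z} := fun z =>
    ENNReal.div_mul_cancel (hν z) (measure_ne_top _ _)
  refine ⟨?_⟩
  rw [withDensity_apply _ .univ, setLIntegral_univ,
    ← lintegral_map (f := fun z => q {z} / ν.map ζ {z}) .of_discrete hζ, lintegral_countable']
  simp_rw [hmap]
  rw [← measure_univ (μ := q), ← lintegral_one, lintegral_countable']
  simp_rw [one_mul]

section Tilt

variable (μ : Measure W) [IsProbabilityMeasure μ] (ξ : Kernel W X) [IsMarkovKernel ξ]
  (K : Kernel X O) [IsMarkovKernel K] (ν : Measure O) [IsProbabilityMeasure ν]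
  {ζ : O → Z} {τ : X × O → ℝ}

/-- Dividing the law of message and output by the information density of `ζ o` and by the
conditional density `exp τ` of `o` given `ζ o` makes the message independent of the output. -/
theorem lintegral_tilt_fullLaw (hτ : Measurable τ)
    (hKZ : ∀ x z, K.map ζ x {z} ≠ 0) (hν : ∀ z, ν.map ζ {z} ≠ 0)
    (hK : ∀ x o, K x {o} * ν.map ζ {ζ o}
      = ENNReal.ofReal (Real.exp (τ (x, o))) * K.map ζ x {ζ o} * ν {o})
    (f : W × O → ℝ≥0∞) :
    ∫⁻ p, f (p.1.1, p.2) * (infoDensity μ (K.map ζ ∘ₖ ξ) (p.1.1, ζ p.2))⁻¹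
        * ENNReal.ofReal (Real.exp (-τ (p.1.2, p.2))) ∂fullLaw μ ξ K
      = ∫⁻ q, f q ∂μ.prod
          (ν.withDensity fun o => ((K.map ζ ∘ₖ ξ) ∘ₘ μ) {ζ o} / ν.map ζ {ζ o}) := by
  have hζ : Measurable ζ := .of_discrete
  have := Kernel.IsMarkovKernel.map K hζ
  have := Measure.isProbabilityMeasure_map (μ := ν) hζ.aemeasurable
  have := isProbabilityMeasure_withDensity_comp ν ζ hν ((K.map ζ ∘ₖ ξ) ∘ₘ μ)
  set i := infoDensity μ (K.map ζ ∘ₖ ξ)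
  have hK' : ∀ x o, ENNReal.ofReal (Real.exp (-τ (x, o))) * K x {o}
      = K.map ζ x {ζ o} * (ν {o} / ν.map ζ {ζ o}) := fun x o => by
    rw [Real.exp_neg, ENNReal.ofReal_inv_of_pos (Real.exp_pos _), ← mul_div_assoc,
      ENNReal.eq_div_iff (hν _) (measure_ne_top _ _), mul_left_comm, mul_comm (ν.map ζ _), hK,
      mul_assoc, ENNReal.inv_mul_cancel_left (by simp [Real.exp_pos]) ENNReal.ofReal_ne_top]
  have : Measurable fun p : (W × X) × O => f (p.1.1, p.2) * (i (p.1.1, ζ p.2))⁻¹ :=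
    (Measurable.of_discrete (f := fun q : W × O => f q * (i (q.1, ζ q.2))⁻¹)).comp
      (f := fun p : (W × X) × O => (p.1.1, p.2)) (by fun_prop)
  rw [lintegral_fullLaw μ ξ K (by fun_prop), lintegral_prod _ (by fun_prop)]
  refine lintegral_congr fun w => ?_
  rw [lintegral_withDensity_eq_lintegral_mul _ .of_discrete .of_discrete,
    lintegral_countable' (μ := ν)]
  simp_rw [fun x => lintegral_countable' (μ := K x), mul_assoc, hK']
  have hmeas : ∀ o, Measurable fun x => K.map ζ x {ζ o} := fun o =>
    (K.map ζ).measurable_coe (measurableSet_singleton _)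
  rw [lintegral_tsum fun o => by fun_prop]
  refine tsum_congr fun o => ?_
  calc ∫⁻ x, f (w, o) * ((i (w, ζ o))⁻¹ * (K.map ζ x {ζ o} * (ν {o} / ν.map ζ {ζ o}))) ∂ξ w
      = f (w, o) * (((i (w, ζ o))⁻¹ * ∫⁻ x, K.map ζ x {ζ o} ∂ξ w)
          * (ν {o} / ν.map ζ {ζ o})) := by
        rw [lintegral_const_mul _ (by fun_prop), lintegral_const_mul _ (by fun_prop),
          lintegral_mul_const _ (hmeas o), mul_assoc]
    _ = _ := by
        rw [lintegral_mul_inv_infoDensity μ ξ (K.map ζ) hKZ]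
        simp only [Pi.mul_apply, div_eq_mul_inv]
        ring

end Tilt

end Converse

section MessageLaw

variable (M : ℕ)

instance [NeZero M] : IsProbabilityMeasure (Code.messageLaw M) :=
  isProbabilityMeasure_uniformOn Set.finite_univ Set.univ_nonempty

theorem messageLaw_singleton (w : Fin M) : Code.messageLaw M {w} = (M : ℝ≥0∞)⁻¹ := by
  rw [Code.messageLaw, uniformOn_univ]
  simp

theorem lintegral_messageLaw (f : Fin M → ℝ≥0∞) :
    ∫⁻ w, f w ∂Code.messageLaw M = (M : ℝ≥0∞)⁻¹ * ∑ w, f w := by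
  rw [lintegral_fintype]
  simp_rw [messageLaw_singleton]
  rw [← Finset.sum_mul, mul_comm]

end MessageLaw

section Guessing

variable {X O Z : Type*} [MeasurableSpace X] [MeasurableSpace O] [MeasurableSpace Z]
  [Countable O] [MeasurableSingletonClass O] {M : ℕ} [NeZero M]

theorem lintegral_messageLaw_prod_guess_le (ν : Measure O) [IsProbabilityMeasure ν]
    (g : O → Fin M) :
    ∫⁻ q, (if g q.2 = q.1 then (M : ℝ≥0∞) else 1) ∂(Code.messageLaw M).prod ν ≤ 2 := by
  have hM : (M : ℝ≥0∞) ≠ 0 := by simp [NeZero.ne M]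
  rw [lintegral_prod_symm _ (by exact Measurable.of_discrete.aemeasurable)]
  refine (lintegral_mono fun o => ?_).trans_eq ((lintegral_const 2).trans (by simp))
  have hsum : ∑ w, (if g o = w then (M : ℝ≥0∞) else 1) ≤ M * 2 := by
    calc ∑ w, (if g o = w then (M : ℝ≥0∞) else 1)
        ≤ ∑ w, ((if g o = w then (M : ℝ≥0∞) else 0) + 1) := by
          gcongr with w
          split_ifs <;> simp
      _ = M * 2 := by
          rw [Finset.sum_add_distrib]
          simp [mul_two]
  rw [lintegral_messageLaw]
  exact (mul_le_mul_right hsum _).trans_eq (ENNReal.inv_mul_cancel_left hM (by simp))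

variable [Countable Z] [MeasurableSingletonClass Z]

variable (ξ : Kernel (Fin M) X) [IsMarkovKernel ξ] (K : Kernel X O) [IsMarkovKernel K]
  (ν : Measure O) [IsProbabilityMeasure ν] {ζ : O → Z} {τ : X × O → ℝ} (g : O → Fin M)

theorem lintegral_exp_guess_sub_le (hτ : Measurable τ)
    (hKZ : ∀ x z, K.map ζ x {z} ≠ 0) (hν : ∀ z, ν.map ζ {z} ≠ 0)
    (hK : ∀ x o, K x {o} * ν.map ζ {ζ o}
      = ENNReal.ofReal (Real.exp (τ (x, o))) * K.map ζ x {ζ o} * ν {o}) :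
    ∫⁻ p, ENNReal.ofReal (Real.exp ({p | g p.2 = p.1.1}.indicator (fun _ => Real.log M) p
        - Real.log (infoDensity (Code.messageLaw M) (K.map ζ ∘ₖ ξ) (p.1.1, ζ p.2)).toReal
        - τ (p.1.2, p.2))) ∂fullLaw (Code.messageLaw M) ξ K ≤ ENNReal.ofReal 2 := by
  have hM : (0 : ℝ) < M := by exact_mod_cast NeZero.pos M
  have hζ : Measurable ζ := .of_discrete
  have := Kernel.IsMarkovKernel.map K hζ
  set κ := K.map ζ ∘ₖ ξ with hκ
  have hκ0 : ∀ w z, κ w {z} ≠ 0 := fun w z => by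
    rw [hκ, Kernel.comp_apply]
    exact comp_singleton_ne_zero _ _ fun x => hKZ x z
  have hexp : ∀ p : (Fin M × X) × O,
      ENNReal.ofReal (Real.exp ({p | g p.2 = p.1.1}.indicator (fun _ => Real.log M) p
        - Real.log (infoDensity (Code.messageLaw M) κ (p.1.1, ζ p.2)).toReal - τ (p.1.2, p.2)))
      = (if g p.2 = p.1.1 then (M : ℝ≥0∞) else 1)
        * (infoDensity (Code.messageLaw M) κ (p.1.1, ζ p.2))⁻¹
        * ENNReal.ofReal (Real.exp (-τ (p.1.2, p.2))) := fun p => by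
    have htop : infoDensity (Code.messageLaw M) κ (p.1.1, ζ p.2) ≠ ∞ :=
      ENNReal.div_ne_top (measure_ne_top _ _) (comp_singleton_ne_zero _ _ fun w => hκ0 w _)
    have hpos : 0 < (infoDensity (Code.messageLaw M) κ (p.1.1, ζ p.2)).toReal :=
      ENNReal.toReal_pos (ENNReal.div_ne_zero.2 ⟨hκ0 _ _, measure_ne_top _ _⟩) htop
    rw [sub_eq_add_neg, Real.exp_add, sub_eq_add_neg, Real.exp_add, Real.exp_neg (Real.log _),
      Real.exp_log hpos, ENNReal.ofReal_mul (by positivity), ENNReal.ofReal_mul (by positivity),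
      ENNReal.ofReal_inv_of_pos hpos, ENNReal.ofReal_toReal htop]
    by_cases hp : g p.2 = p.1.1
    · simp [hp, Real.exp_log hM]
    · simp [hp]
  simp_rw [hexp]
  have := isProbabilityMeasure_withDensity_comp ν ζ hν (κ ∘ₘ Code.messageLaw M)
  rw [lintegral_tilt_fullLaw (Code.messageLaw M) ξ K ν hτ hKZ hν hK
    fun q => if g q.2 = q.1 then (M : ℝ≥0∞) else 1]
  simpa using lintegral_messageLaw_prod_guess_le _ g

/-- What the output `o` reveals about the message beyond `ζ o` is at most the mean of the logarithm
`τ` of the conditional density of `o` given `ζ o` and the input. -/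
theorem measureReal_correct_mul_log_le (hτ : Measurable τ)
    (hτint : Integrable τ ((ξ ∘ₘ Code.messageLaw M) ⊗ₘ K))
    (hKZ : ∀ x z, K.map ζ x {z} ≠ 0) (hν : ∀ z, ν.map ζ {z} ≠ 0)
    (hK : ∀ x o, K x {o} * ν.map ζ {ζ o}
      = ENNReal.ofReal (Real.exp (τ (x, o))) * K.map ζ x {ζ o} * ν {o})
    (hfin : mutualInfo (Code.messageLaw M ⊗ₘ (K.map ζ ∘ₖ ξ)) ≠ ∞) :
    (fullLaw (Code.messageLaw M) ξ K).real {p | g p.2 = p.1.1} * Real.log M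
      ≤ Real.log 2 + (mutualInfo (Code.messageLaw M ⊗ₘ (K.map ζ ∘ₖ ξ))).toReal
        + ∫ q, τ q ∂((ξ ∘ₘ Code.messageLaw M) ⊗ₘ K) := by
  have hζ : Measurable ζ := .of_discrete
  have := Kernel.IsMarkovKernel.map K hζ
  have hpair : Measurable fun p : (Fin M × X) × O => (p.1.1, ζ p.2) := by fun_prop
  have hio : Measurable fun p : (Fin M × X) × O => (p.1.2, p.2) := by fun_prop
  have hcorrect : MeasurableSet {p : (Fin M × X) × O | g p.2 = p.1.1} :=
    measurableSet_eq_fun ((Measurable.of_discrete (f := g)).comp measurable_snd) (by fun_prop)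
  set κ := K.map ζ ∘ₖ ξ with hκ
  have hout : ∀ z, (κ ∘ₘ Code.messageLaw M) {z} ≠ 0 := fun z =>
    comp_singleton_ne_zero _ _ fun w => by
      rw [hκ, Kernel.comp_apply]
      exact comp_singleton_ne_zero _ _ fun x => hKZ x z
  have hinfo_int := integrable_log_infoDensity _ κ hout hfin
  have hinfo := integral_log_infoDensity (Code.messageLaw M) κ hout
  rw [← map_fullLaw_message_output (Code.messageLaw M) ξ K hζ] at hinfo_int hinfo
  rw [integral_map hpair.aemeasurable (by exact Measurable.of_discrete.aestronglyMeasurable),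
    map_fullLaw_message_output _ ξ K hζ] at hinfo
  rw [← map_fullLaw_input_output] at hτint ⊢
  have hind : Integrable ({p : (Fin M × X) × O | g p.2 = p.1.1}.indicator fun _ => Real.log M)
      (fullLaw (Code.messageLaw M) ξ K) := (integrable_const _).indicator hcorrect
  have hinfo_int' := hinfo_int.comp_measurable hpair
  have hτint' := hτint.comp_measurable hio
  have hjensen := integral_le_log_of_lintegral_exp_le ((hind.sub hinfo_int').sub hτint') two_pos
    (lintegral_exp_guess_sub_le ξ K ν g hτ hKZ hν hK)
  rw [integral_sub' (hind.sub hinfo_int') hτint', integral_sub' hind hinfo_int',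
    integral_indicator_const _ hcorrect] at hjensen
  simp only [Function.comp_def, smul_eq_mul] at hjensen
  rw [hinfo] at hjensen
  rw [integral_map hio.aemeasurable hτ.aestronglyMeasurable]
  linarith

end Guessing

section Poisson

theorem poissonMeasure_singleton_ne_zero {r : ℝ≥0} (hr : 0 < r) (k : ℕ) :
    poissonMeasure r {k} ≠ 0 := by
  rw [poissonMeasure_singleton]
  simp only [ne_eq, ENNReal.ofReal_eq_zero, not_le]
  positivity

theorem hasSum_poissonMeasure_natCast (r : ℝ≥0) :
    HasSum (fun k : ℕ => Real.exp (-r) * r ^ k / k.factorial * k) r := by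
  rw [← hasSum_nat_add_iff' 1]
  convert! (hasSum_one_poissonMeasure r).mul_left (r : ℝ) using 1
  · funext k
    rw [Nat.factorial_succ]
    push_cast
    field_simp
    ring
  · simp

theorem integrable_natCast_poissonMeasure (r : ℝ≥0) :
    Integrable (fun k : ℕ => (k : ℝ)) (poissonMeasure r) := by
  rw [integrable_poissonMeasure_iff]
  simpa using (hasSum_poissonMeasure_natCast r).summable

theorem integral_natCast_poissonMeasure (r : ℝ≥0) : ∫ k, (k : ℝ) ∂poissonMeasure r = r := by
  rw [integral_poissonMeasure]
  exact (hasSum_poissonMeasure_natCast r).tsum_eq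

theorem poissonMeasure_add_mul_singleton {r : ℝ≥0} (hr : 0 < r) (s t : ℝ≥0) (k : ℕ) :
    poissonMeasure ((s + r) * t) {k}
      = ENNReal.ofReal (Real.exp (Real.log (1 + s / r) * k - s * t))
        * poissonMeasure (r * t) {k} := by
  have : (0 : ℝ) < r := hr
  have hpow : Real.exp (Real.log (1 + s / r) * k) = (1 + s / r : ℝ) ^ k := by
    rw [mul_comm, Real.exp_nat_mul, Real.exp_log (by positivity)]
  have hmean : ((s : ℝ) + r) * t = (1 + s / r) * (r * t) := by field_simp; ring
  have hexp : Real.exp (-((s + r) * t : ℝ)) = Real.exp (-(s * t : ℝ)) * Real.exp (-(r * t)) := by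
    rw [← Real.exp_add]; congr 1; ring
  rw [poissonMeasure_singleton, poissonMeasure_singleton, ← ENNReal.ofReal_mul (by positivity),
    sub_eq_add_neg, Real.exp_add, hpow]
  congr 1
  push_cast
  rw [hexp, hmean, mul_pow]
  ring

end Poisson

theorem map_add_prod_pi {ι A : Type*} [Fintype ι] [AddMonoid A] [MeasurableSpace A]
    [MeasurableAdd₂ A] (μ ν : ι → Measure A) [∀ i, IsProbabilityMeasure (μ i)]
    [∀ i, IsProbabilityMeasure (ν i)] :
    ((Measure.pi μ).prod (Measure.pi ν)).map (fun p => p.1 + p.2)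
      = Measure.pi fun i => (μ i).conv (ν i) := by
  have harrow := measurePreserving_arrowProdEquivProdArrow A A ι μ ν
  have : ∀ i, IsProbabilityMeasure (((μ i).prod (ν i)).map fun p => p.1 + p.2) := fun i =>
    Measure.isProbabilityMeasure_map (by fun_prop)
  rw [← harrow.map_eq, Measure.map_map (by fun_prop) (by fun_prop)]
  exact Measure.pi_map_pi (μ := fun i => (μ i).prod (ν i)) (f := fun _ (p : A × A) => p.1 + p.2)
    fun i => by fun_prop

section Channel

variable {α Δ : ℝ≥0} {n : ℕ}

theorem channelN_apply (α lam Δ : ℝ≥0) (n : ℕ) (x : Fin n → ℝ≥0) :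
    channelN α lam Δ n x = Measure.pi fun i => poissonMeasure ((α * x i + lam) * Δ) := rfl

theorem channelN_singleton_ne_zero {lam : ℝ≥0} (hlam : 0 < lam) (hΔ : 0 < Δ) (x : Fin n → ℝ≥0)
    (y : Fin n → ℕ) : channelN α lam Δ n x {y} ≠ 0 := by
  rw [channelN_apply, Measure.pi_singleton]
  exact Finset.prod_ne_zero_iff.2 fun i _ => poissonMeasure_singleton_ne_zero (by positivity) _

/-- The logarithm of the likelihood ratio, at the counts `y`, of the inputs `x` and `0`. -/
noncomputable def logLikelihood (α lam Δ : ℝ≥0) (x : Fin n → ℝ≥0) (y : Fin n → ℕ) : ℝ :=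
  ∑ i, (Real.log (1 + α * x i / lam) * y i - α * x i * Δ)

theorem channelN_singleton {lam : ℝ≥0} (hlam : 0 < lam) (x : Fin n → ℝ≥0) (y : Fin n → ℕ) :
    channelN α lam Δ n x {y}
      = ENNReal.ofReal (Real.exp (logLikelihood α lam Δ x y)) * channelN α lam Δ n 0 {y} := by
  rw [channelN_apply, channelN_apply, Measure.pi_singleton, Measure.pi_singleton, logLikelihood,
    Real.exp_sum, ENNReal.ofReal_prod_of_nonneg fun i _ => (Real.exp_pos _).le,
    ← Finset.prod_mul_distrib]
  refine Finset.prod_congr rfl fun i _ => ?_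
  rw [poissonMeasure_add_mul_singleton hlam]
  simp

/-- Independent Poisson counts of parameter `r` in each of `n` slots. -/
noncomputable def darkCounts (r : ℝ≥0) (n : ℕ) : Measure (Fin n → ℕ) :=
  Measure.pi fun _ => poissonMeasure r

instance (r : ℝ≥0) : IsProbabilityMeasure (darkCounts r n) := by
  rw [darkCounts]
  infer_instance

/-- The counts of a receiver of dark current `lam`, together with the additional dark counts, of
rate `d`, which turn them into the counts of a receiver of dark current `lam + d`. -/
noncomputable def pairChannel (α lam d Δ : ℝ≥0) (n : ℕ) :
    Kernel (Fin n → ℝ≥0) ((Fin n → ℕ) × (Fin n → ℕ)) :=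
  channelN α lam Δ n ×ₖ Kernel.const _ (darkCounts (d * Δ) n)

instance (α lam d Δ : ℝ≥0) : IsMarkovKernel (pairChannel α lam d Δ n) := by
  rw [pairChannel]
  infer_instance

theorem pairChannel_apply (α lam d Δ : ℝ≥0) (x : Fin n → ℝ≥0) :
    pairChannel α lam d Δ n x = (channelN α lam Δ n x).prod (darkCounts (d * Δ) n) := by
  rw [pairChannel, Kernel.prod_apply, Kernel.const_apply]

theorem map_fst_pairChannel (α lam d Δ : ℝ≥0) (n : ℕ) :
    (pairChannel α lam d Δ n).map Prod.fst = channelN α lam Δ n := by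
  rw [← Kernel.fst_eq, pairChannel, Kernel.fst_prod]

theorem map_add_pairChannel (α lam d Δ : ℝ≥0) (n : ℕ) :
    (pairChannel α lam d Δ n).map (fun o => o.1 + o.2) = channelN α (lam + d) Δ n := by
  ext1 x
  rw [Kernel.map_apply _ (by fun_prop), pairChannel_apply, channelN_apply, channelN_apply,
    darkCounts, map_add_prod_pi]
  simp_rw [poissonMeasure_conv_poissonMeasure, ← add_mul, add_assoc]

theorem integrable_pairChannel_fst (α lam d Δ : ℝ≥0) (x : Fin n → ℝ≥0) (i : Fin n) :
    Integrable (fun o => (o.1 i : ℝ)) (pairChannel α lam d Δ n x) := by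
  rw [pairChannel_apply, channelN_apply]
  exact (integrable_comp_eval (integrable_natCast_poissonMeasure _)).comp_fst _

theorem integral_pairChannel_fst (α lam d Δ : ℝ≥0) (x : Fin n → ℝ≥0) (i : Fin n) :
    ∫ o, (o.1 i : ℝ) ∂pairChannel α lam d Δ n x = (α * x i + lam) * Δ := by
  rw [pairChannel_apply, integral_fun_fst (fun k : Fin n → ℕ => (k i : ℝ)), channelN_apply,
    integral_comp_eval (X := fun _ => ℕ) (f := fun k : ℕ => (k : ℝ)) .of_discrete,
    integral_natCast_poissonMeasure]
  simp

theorem integrable_pairChannel_snd (α lam d Δ : ℝ≥0) (x : Fin n → ℝ≥0) (i : Fin n) :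
    Integrable (fun o => (o.2 i : ℝ)) (pairChannel α lam d Δ n x) := by
  rw [pairChannel_apply, darkCounts]
  exact (integrable_comp_eval (integrable_natCast_poissonMeasure _)).comp_snd _

theorem integral_pairChannel_snd (α lam d Δ : ℝ≥0) (x : Fin n → ℝ≥0) (i : Fin n) :
    ∫ o, (o.2 i : ℝ) ∂pairChannel α lam d Δ n x = d * Δ := by
  rw [pairChannel_apply, integral_fun_snd (fun k : Fin n → ℕ => (k i : ℝ)), darkCounts,
    integral_comp_eval (X := fun _ => ℕ) (f := fun k : ℕ => (k : ℝ)) .of_discrete,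
    integral_natCast_poissonMeasure]
  simp

/-- The logarithm of the conditional density of the pair `o` given `o.1 + o.2`, for the input `x`,
relative to the same density for the input `0`. -/
noncomputable def degradationLog (α lam d Δ : ℝ≥0) (x : Fin n → ℝ≥0)
    (o : (Fin n → ℕ) × (Fin n → ℕ)) : ℝ :=
  logLikelihood α lam Δ x o.1 - logLikelihood α (lam + d) Δ x (o.1 + o.2)

theorem degradationLog_eq_sum (α lam d Δ : ℝ≥0) (x : Fin n → ℝ≥0)
    (o : (Fin n → ℕ) × (Fin n → ℕ)) :
    degradationLog α lam d Δ x o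
      = ∑ i, ((Real.log (1 + α * x i / lam) - Real.log (1 + α * x i / (lam + d))) * o.1 i
        - Real.log (1 + α * x i / (lam + d)) * o.2 i) := by
  rw [degradationLog, logLikelihood, logLikelihood, ← Finset.sum_sub_distrib]
  refine Finset.sum_congr rfl fun i _ => ?_
  push_cast [Pi.add_apply]
  ring

theorem pairChannel_singleton_mul {lam : ℝ≥0} (hlam : 0 < lam) (d : ℝ≥0) (x : Fin n → ℝ≥0)
    (o : (Fin n → ℕ) × (Fin n → ℕ)) :
    pairChannel α lam d Δ n x {o} * channelN α (lam + d) Δ n 0 {o.1 + o.2}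
      = ENNReal.ofReal (Real.exp (degradationLog α lam d Δ x o))
        * channelN α (lam + d) Δ n x {o.1 + o.2} * pairChannel α lam d Δ n 0 {o} := by
  have hpair : ∀ x, pairChannel α lam d Δ n x {o}
      = channelN α lam Δ n x {o.1} * darkCounts (d * Δ) n {o.2} := fun x => by
    rw [pairChannel_apply, ← Measure.prod_prod, Set.singleton_prod_singleton]
  have hexp : ENNReal.ofReal (Real.exp (logLikelihood α lam Δ x o.1))
      = ENNReal.ofReal (Real.exp (degradationLog α lam d Δ x o))
        * ENNReal.ofReal (Real.exp (logLikelihood α (lam + d) Δ x (o.1 + o.2))) := by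
    rw [← ENNReal.ofReal_mul (Real.exp_pos _).le, ← Real.exp_add, degradationLog, sub_add_cancel]
  rw [hpair, hpair, channelN_singleton hlam, channelN_singleton (lam := lam + d) (by positivity) x,
    hexp]
  ring

end Channel

section DegradationGain

theorem mul_log_add_mul_log_le {b e u : ℝ} (hb : 0 < b) (hbe : b ≤ e) (hu : 0 ≤ u) :
    (u + b) * Real.log (u + b) + e * Real.log e
      ≤ b * Real.log b + (u + e) * Real.log (u + e) := by
  obtain rfl | hu' := hu.eq_or_lt
  · simp
  -- Convexity of `t * log t`: `e` and `u + b` are mirror images in the interval `[b, u + e]`.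
  have hw : 0 < u + e - b := by linarith
  set w := u / (u + e - b) with hw_def
  have hw0 : 0 ≤ w := by positivity
  have hw1 : 0 ≤ 1 - w := by
    rw [sub_nonneg, hw_def, div_le_one hw]
    linarith
  have hmul : w * (u + e - b) = u := div_mul_cancel₀ u hw.ne'
  have hb_mem : b ∈ Set.Ici (0 : ℝ) := hb.le
  have hue_mem : u + e ∈ Set.Ici (0 : ℝ) := by
    rw [Set.mem_Ici]
    linarith
  have h₁ := Real.convexOn_mul_log.2 hb_mem hue_mem hw0 hw1 (by ring)
  have h₂ := Real.convexOn_mul_log.2 hb_mem hue_mem hw1 hw0 (by ring)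
  simp only [smul_eq_mul] at h₁ h₂
  rw [show w * b + (1 - w) * (u + e) = e by linear_combination -hmul] at h₁
  rw [show (1 - w) * b + w * (u + e) = u + b by linear_combination hmul] at h₂
  linarith

theorem mean_degradation_le {b e u : ℝ} (hb : 0 < b) (hbe : b ≤ e) (hu : 0 ≤ u) :
    (Real.log (1 + u / b) - Real.log (1 + u / e)) * (u + b) - Real.log (1 + u / e) * (e - b)
      ≤ u * Real.log (e / b) := by
  have he : 0 < e := hb.trans_le hbe
  have hlog : ∀ c : ℝ, 0 < c → Real.log (1 + u / c) = Real.log (u + c) - Real.log c := by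
    intro c hc
    rw [← Real.log_div (by positivity) hc.ne', add_div, div_self hc.ne', add_comm]
  rw [hlog b hb, hlog e he, Real.log_div he.ne' hb.ne']
  linarith [mul_log_add_mul_log_le hb hbe hu]

theorem log_one_add_div_anti {b e u : ℝ} (hb : 0 < b) (hbe : b ≤ e) (hu : 0 ≤ u) :
    Real.log (1 + u / e) ≤ Real.log (1 + u / b) := by
  have he : 0 < e := hb.trans_le hbe
  gcongr

theorem log_one_add_div_sub_le {b e u : ℝ} (hb : 0 < b) (hbe : b ≤ e) (hu : 0 ≤ u) :
    Real.log (1 + u / b) - Real.log (1 + u / e) ≤ Real.log (e / b) := by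
  have he : 0 < e := hb.trans_le hbe
  rw [← Real.log_div (by positivity) (by positivity)]
  refine Real.log_le_log (by positivity) ?_
  rw [div_le_div_iff₀ (by positivity) hb, show (1 + u / b) * b = b + u by field_simp,
    show e * (1 + u / e) = e + u by field_simp]
  linarith

end DegradationGain

theorem integrable_mul_compProd {X O : Type*} [MeasurableSpace X] [MeasurableSpace O]
    {μ : Measure X} [SFinite μ] {κ : Kernel X O} [IsSFiniteKernel κ] {a : X → ℝ} {f : O → ℝ}
    (ha : Measurable a) (hf : Measurable f) (hf0 : 0 ≤ f) (hfint : ∀ x, Integrable f (κ x))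
    (hint : Integrable (fun x => a x * ∫ o, f o ∂κ x) μ) :
    Integrable (fun p => a p.1 * f p.2) (μ ⊗ₘ κ) := by
  rw [Measure.integrable_compProd_iff (by fun_prop)]
  refine ⟨ae_of_all _ fun x => (hfint x).const_mul (a x), ?_⟩
  convert! hint.norm using 2 with x
  simp_rw [norm_mul]
  rw [integral_const_mul, Real.norm_of_nonneg (integral_nonneg hf0)]
  simp_rw [fun o => Real.norm_of_nonneg (hf0 o)]

section Degradation

variable {n : ℕ} {lam : ℝ≥0} (α d Δ : ℝ≥0)

theorem integral_pairChannel_degradationLog_le (hlam : 0 < lam) (x : Fin n → ℝ≥0) :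
    ∫ o, degradationLog α lam d Δ x o ∂pairChannel α lam d Δ n x
      ≤ Δ * (α * Real.log ((lam + d) / lam)) * ∑ i, (x i : ℝ) := by
  have hfst := fun i => integrable_pairChannel_fst α lam d Δ x i
  have hsnd := fun i => integrable_pairChannel_snd α lam d Δ x i
  simp_rw [degradationLog_eq_sum]
  rw [Finset.mul_sum]
  refine (integral_finsetSum _
    fun i _ => ((hfst i).const_mul _).sub ((hsnd i).const_mul _)).trans_le
    (Finset.sum_le_sum fun i _ => ?_)
  rw [integral_sub' ((hfst i).const_mul _) ((hsnd i).const_mul _), integral_const_mul,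
    integral_const_mul, integral_pairChannel_fst, integral_pairChannel_snd]
  have hmean := mean_degradation_le (u := α * x i) (b := lam) (e := lam + d) hlam
    (le_add_of_nonneg_right NNReal.zero_le_coe) (by positivity)
  linarith [mul_le_mul_of_nonneg_right hmean (NNReal.zero_le_coe (q := Δ))]

variable {P : Measure (Fin n → ℝ≥0)} [IsProbabilityMeasure P]

theorem integrable_degradationLog (hlam : 0 < lam)
    (hP : ∀ i, Integrable (fun x => (x i : ℝ)) P) :
    Integrable (fun p => degradationLog α lam d Δ p.1 p.2) (P ⊗ₘ pairChannel α lam d Δ n) := by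
  have hb : (0 : ℝ) < lam := hlam
  have hbe : (lam : ℝ) ≤ lam + d := le_add_of_nonneg_right NNReal.zero_le_coe
  simp_rw [degradationLog_eq_sum]
  refine integrable_finsetSum _ fun i _ => .sub ?_ ?_
  · refine integrable_mul_compProd (κ := pairChannel α lam d Δ n)
      (a := fun x => Real.log (1 + α * x i / lam) - Real.log (1 + α * x i / (lam + d)))
      (f := fun o => (o.1 i : ℝ)) (by fun_prop) (by fun_prop) (fun _ => Nat.cast_nonneg _)
      (fun x => integrable_pairChannel_fst α lam d Δ x i) ?_
    simp_rw [integral_pairChannel_fst]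
    refine Integrable.bdd_mul (c := Real.log ((lam + d) / lam))
      ((((hP i).const_mul _).add (integrable_const _)).mul_const _)
      (Measurable.aestronglyMeasurable (by fun_prop)) (ae_of_all _ fun x => ?_)
    rw [Real.norm_of_nonneg (sub_nonneg.2 (log_one_add_div_anti hb hbe (by positivity)))]
    exact log_one_add_div_sub_le hb hbe (by positivity)
  · refine integrable_mul_compProd (κ := pairChannel α lam d Δ n)
      (a := fun x => Real.log (1 + α * x i / (lam + d)))
      (f := fun o => (o.2 i : ℝ)) (by fun_prop) (by fun_prop) (fun _ => Nat.cast_nonneg _)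
      (fun x => integrable_pairChannel_snd α lam d Δ x i) ?_
    simp_rw [integral_pairChannel_snd]
    refine Integrable.mul_const (Integrable.mono' (((hP i).const_mul (α : ℝ)).div_const (lam + d))
      (Measurable.aestronglyMeasurable (by fun_prop)) (ae_of_all _ fun x => ?_)) _
    have hpos : 0 < 1 + α * x i / (lam + d : ℝ) := by positivity
    rw [Real.norm_of_nonneg (Real.log_nonneg (le_add_of_nonneg_right (by positivity)))]
    linarith [Real.log_le_sub_one_of_pos hpos]

theorem integral_degradationLog_le (hlam : 0 < lam)
    (hP : ∀ i, Integrable (fun x => (x i : ℝ)) P) :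
    ∫ p, degradationLog α lam d Δ p.1 p.2 ∂(P ⊗ₘ pairChannel α lam d Δ n)
      ≤ Δ * (α * Real.log ((lam + d) / lam)) * ∑ i, ∫ x, (x i : ℝ) ∂P := by
  have hint := integrable_degradationLog α d Δ hlam hP
  rw [Measure.integral_compProd hint, ← integral_finsetSum _ fun i _ => hP i, ← integral_const_mul]
  exact integral_mono hint.integral_compProd
    ((integrable_finsetSum _ fun i _ => hP i).const_mul _)
    fun x => integral_pairChannel_degradationLog_le α d Δ hlam x

end Degradation

section CodeConverse

variable {n M : ℕ} {c : Code n M} {α lB lE Δ E : ℝ≥0}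

theorem integrable_inputLaw (hE : c.MeetsAverage E) (i : Fin n) :
    Integrable (fun x => (x i : ℝ)) c.inputLaw := by
  refine ⟨Measurable.aestronglyMeasurable (by fun_prop), ?_⟩
  simp_rw [hasFiniteIntegral_iff_ofReal (ae_of_all _ fun _ => NNReal.zero_le_coe),
    ENNReal.ofReal_coe_nnreal]
  exact ((Finset.single_le_sum (f := fun i => ∫⁻ x, (x i : ℝ≥0∞) ∂c.inputLaw)
    (fun _ _ => zero_le) (Finset.mem_univ i)).trans hE).trans_lt (by finiteness)

theorem sum_integral_inputLaw_le (hE : c.MeetsAverage E) :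
    ∑ i, ∫ x, (x i : ℝ) ∂c.inputLaw ≤ n * E := by
  have hmean : ∀ i, ENNReal.ofReal (∫ x, (x i : ℝ) ∂c.inputLaw)
      = ∫⁻ x, (x i : ℝ≥0∞) ∂c.inputLaw := fun i => by
    simp_rw [ofReal_integral_eq_lintegral_ofReal (integrable_inputLaw hE i)
      (ae_of_all _ fun _ => NNReal.zero_le_coe), ENNReal.ofReal_coe_nnreal]
  rw [← ENNReal.ofReal_le_ofReal_iff (by positivity),
    ENNReal.ofReal_sum_of_nonneg fun i _ => integral_nonneg fun x => NNReal.zero_le_coe,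
    ENNReal.ofReal_mul (by positivity)]
  simpa [hmean, Code.MeetsAverage] using hE

variable [NeZero M]

instance : IsProbabilityMeasure c.inputLaw := by
  rw [Code.inputLaw]
  infer_instance

theorem fullLaw_real_correct (c : Code n M) (α lam d Δ : ℝ≥0) :
    (fullLaw (Code.messageLaw M) c.encoder (pairChannel α lam d Δ n)).real
        {p | c.decoder p.2.1 = p.1.1} = 1 - (c.errorProb α lam Δ).toReal := by
  have hpair : Measurable fun p : (Fin M × (Fin n → ℝ≥0)) × (Fin n → ℕ) × (Fin n → ℕ) =>
      (p.1.1, p.2.1) := by fun_prop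
  have hjoint := map_fullLaw_message_output (Code.messageLaw M) c.encoder
    (pairChannel α lam d Δ n) measurable_fst
  rw [map_fst_pairChannel] at hjoint
  have hcorrect : MeasurableSet {q : Fin M × (Fin n → ℕ) | c.decoder q.2 = q.1} := .of_discrete
  have := probReal_compl_eq_one_sub (μ := fullLaw (Code.messageLaw M) c.encoder
    (pairChannel α lam d Δ n)) (hpair hcorrect.compl)
  rw [Code.errorProb, Code.jointLaw, ← hjoint, ← measureReal_def,
    map_measureReal_apply hpair .of_discrete]
  exact (congrArg _ (Set.ext fun p => not_not.symm)).trans this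

theorem one_sub_errorProb_mul_log_le (hlB : 0 < lB) (hle : lB ≤ lE) (hΔ : 0 < Δ)
    (hE : c.MeetsAverage E) (hfin : c.leakage α lE Δ ≠ ∞) :
    (1 - (c.errorProb α lB Δ).toReal) * Real.log M
      ≤ Real.log 2 + (c.leakage α lE Δ).toReal + n * Δ * (α * E * Real.log (lE / lB)) := by
  obtain ⟨d, rfl⟩ := exists_add_of_le hle
  have hlog : 0 ≤ Real.log ((lB + d : ℝ≥0) / lB) :=
    Real.log_nonneg ((one_le_div (NNReal.coe_pos.2 hlB)).2 (NNReal.coe_le_coe.2 hle))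
  have hmap := map_add_pairChannel α lB d Δ n
  have hmap0 : (pairChannel α lB d Δ n 0).map (fun o => o.1 + o.2) = channelN α (lB + d) Δ n 0 := by
    rw [← hmap, Kernel.map_apply _ .of_discrete]
  have hτ : Measurable fun p : (Fin n → ℝ≥0) × (Fin n → ℕ) × (Fin n → ℕ) =>
      degradationLog α lB d Δ p.1 p.2 := by
    simp_rw [degradationLog_eq_sum]
    fun_prop
  have hconverse := measureReal_correct_mul_log_le c.encoder (pairChannel α lB d Δ n)
    (pairChannel α lB d Δ n 0) (fun o => c.decoder o.1) hτ
    (integrable_degradationLog α d Δ hlB (integrable_inputLaw hE))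
    (fun x z => hmap ▸ channelN_singleton_ne_zero (by positivity) hΔ x z)
    (fun z => hmap0 ▸ channelN_singleton_ne_zero (by positivity) hΔ 0 z)
    (fun x o => by rw [hmap, hmap0]; exact pairChannel_singleton_mul hlB d x o)
    (by rw [hmap]; exact hfin)
  rw [hmap, fullLaw_real_correct] at hconverse
  have hgain := (integral_degradationLog_le α d Δ hlB (integrable_inputLaw hE)).trans
    (mul_le_mul_of_nonneg_left (sum_integral_inputLaw_le hE) (by simpa using by positivity))
  calc _ ≤ _ := hconverse
    _ ≤ Real.log 2 + (c.leakage α (lB + d) Δ).toReal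
        + Δ * (α * Real.log ((lB + d) / lB)) * (n * E) := add_le_add le_rfl hgain
    _ = _ := by
      push_cast
      ring

theorem errorProb_le_one (c : Code n M) (α lam Δ : ℝ≥0) : c.errorProb α lam Δ ≤ 1 := by
  have : IsProbabilityMeasure (c.jointLaw α lam Δ) := by
    rw [Code.jointLaw]
    infer_instance
  exact prob_le_one

end CodeConverse

section CapacityConverse

variable {α lB lE Δ E : ℝ≥0}

instance (x : ℝ) : NeZero ⌈Real.exp x⌉₊ := ⟨(Nat.ceil_pos.2 (Real.exp_pos x)).ne'⟩

theorem le_log_ceil_exp (x : ℝ) : x ≤ Real.log ⌈Real.exp x⌉₊ := by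
  rw [Real.le_log_iff_exp_le (Nat.cast_pos.2 (Nat.ceil_pos.2 (Real.exp_pos x)))]
  exact Nat.le_ceil _

theorem one_sub_errorProb_mul_rate_le {n : ℕ} {R : ℝ} {c : Code n ⌈Real.exp (n * Δ * R)⌉₊}
    (hlB : 0 < lB) (hle : lB ≤ lE) (hΔ : 0 < Δ) (hn : 0 < n) (hE : c.MeetsAverage E)
    (hfin : c.leakage α lE Δ / n ≠ ∞) :
    (1 - (c.errorProb α lB Δ).toReal) * (Δ * R)
      ≤ Real.log 2 / n + (c.leakage α lE Δ / n).toReal + Δ * (α * E * Real.log (lE / lB)) := by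
  have hn' : (0 : ℝ) < n := Nat.cast_pos.2 hn
  have hleak : c.leakage α lE Δ ≠ ∞ := fun h => by
    rw [h, ENNReal.top_div_of_ne_top (ENNReal.natCast_ne_top n)] at hfin
    exact hfin rfl
  have hcorrect : 0 ≤ 1 - (c.errorProb α lB Δ).toReal :=
    sub_nonneg.2 (ENNReal.toReal_mono ENNReal.one_ne_top (errorProb_le_one c α lB Δ))
  have hlog := (mul_le_mul_of_nonneg_left (le_log_ceil_exp (n * Δ * R)) hcorrect).trans
    (one_sub_errorProb_mul_log_le hlB hle hΔ hE hleak)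
  rw [ENNReal.toReal_div, ENNReal.toReal_natCast, ← add_div, ← sub_le_iff_le_add, le_div_iff₀ hn']
  linarith

theorem IsSecureRate.le {R : ℝ≥0} (hlB : 0 < lB) (hle : lB ≤ lE) (hΔ : 0 < Δ)
    (hR : IsSecureRate α lB α lE Δ E R) : (R : ℝ) ≤ α * E * Real.log (lE / lB) := by
  obtain ⟨c, havg, herr, hleak⟩ := hR
  have herr' := (ENNReal.tendsto_toReal ENNReal.zero_ne_top).comp herr
  have hleak' := (ENNReal.tendsto_toReal ENNReal.zero_ne_top).comp hleak
  have hlog2 : Tendsto (fun n : ℕ => Real.log 2 / n) atTop (𝓝 0) :=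
    tendsto_const_nhds.div_atTop tendsto_natCast_atTop_atTop
  have hlim := le_of_tendsto_of_tendsto ((herr'.const_sub 1).mul_const (Δ * R : ℝ))
    ((hlog2.add hleak').add_const (Δ * (α * E * Real.log (lE / lB)))) <| by
      filter_upwards [hleak.eventually_ne ENNReal.zero_ne_top, eventually_gt_atTop 0]
        with n hfin hn
      exact one_sub_errorProb_mul_rate_le hlB hle hΔ hn (havg n) hfin
  simp only [ENNReal.toReal_zero, sub_zero, one_mul, zero_add] at hlim
  exact le_of_mul_le_mul_left hlim (NNReal.coe_pos.2 hΔ)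

theorem secrecyCapacity_le (hlB : 0 < lB) (hle : lB ≤ lE) (hΔ : 0 < Δ) (α E : ℝ≥0) :
    secrecyCapacity α lB α lE Δ E ≤ ENNReal.ofReal (α * Real.log (lE / lB)) * E := by
  refine iSup₂_le fun R hR => ?_
  rw [← ENNReal.ofReal_coe_nnreal, ← ENNReal.ofReal_coe_nnreal (p := E),
    ← ENNReal.ofReal_mul' NNReal.zero_le_coe]
  exact ENNReal.ofReal_le_ofReal (by linarith [hR.le hlB hle hΔ])

end CapacityConverse

section ProductMeasure

theorem lintegral_pi_prod {ι : Type*} [Fintype ι] {X : ι → Type*} [∀ i, MeasurableSpace (X i)]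
    (μ : ∀ i, Measure (X i)) [∀ i, IsProbabilityMeasure (μ i)] {f : ∀ i, X i → ℝ≥0∞}
    (hf : ∀ i, Measurable (f i)) :
    ∫⁻ x, ∏ i, f i (x i) ∂Measure.pi μ = ∏ i, ∫⁻ t, f i t ∂μ i :=
  (lintegral_prod_eq_prod_lintegral_of_indepFun _ _ (iIndepFun_pi fun i => (hf i).aemeasurable)
    fun i => (hf i).comp (measurable_pi_apply i)).trans <|
    Finset.prod_congr rfl fun i _ => (measurePreserving_eval μ i).lintegral_comp (hf i)

theorem lintegral_rpow_le_rpow_lintegral {Ω : Type*} [MeasurableSpace Ω] (μ : Measure Ω)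
    [IsProbabilityMeasure μ] {f : Ω → ℝ≥0∞} (hf : Measurable f) {ρ : ℝ} (hρ : 0 < ρ)
    (hρ1 : ρ ≤ 1) : ∫⁻ ω, f ω ^ ρ ∂μ ≤ (∫⁻ ω, f ω ∂μ) ^ ρ := by
  have hnorm := eLpNorm'_le_eLpNorm'_of_exponent_le hρ hρ1 μ hf.aestronglyMeasurable
  simp only [eLpNorm', enorm_eq_self, ENNReal.rpow_one, one_div, inv_one] at hnorm
  exact (ENNReal.rpow_inv_le_iff hρ).1 hnorm

variable {ι S : Type*} [Fintype ι] [MeasurableSpace S] (q : Measure S) [IsProbabilityMeasure q]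

theorem lintegral_pi_eval (j : ι) {f : S → ℝ≥0∞} (hf : Measurable f) :
    ∫⁻ x, f (x j) ∂Measure.pi (fun _ : ι => q) = ∫⁻ s, f s ∂q :=
  (measurePreserving_eval (fun _ : ι => q) j).lintegral_comp hf

theorem lintegral_mul_rpow_sum_le {ρ : ℝ} (hρ : 0 < ρ) (hρ1 : ρ ≤ 1) (t : Finset ι) {j : ι}
    (hj : j ∉ t) {h g : S → ℝ≥0∞} (hh : Measurable h) (hg : Measurable g) :
    ∫⁻ x, h (x j) * (∑ i ∈ t, g (x i)) ^ ρ ∂Measure.pi (fun _ : ι => q)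
      ≤ (∫⁻ s, h s ∂q) * (t.card * ∫⁻ s, g s ∂q) ^ ρ := by
  classical
  set Q := Measure.pi fun _ : ι => q
  let X : ι → (ι → S) → ℝ≥0∞ := fun i x => if i = j then h (x i) else g (x i)
  have hX : ∀ i, Measurable fun s => if i = j then h s else g s := fun i => by
    split_ifs <;> assumption
  have hind : iIndepFun X Q := iIndepFun_pi fun i => (hX i).aemeasurable
  have hXsum : ∑ i ∈ t, X i = fun x => ∑ i ∈ t, g (x i) := by
    ext x
    rw [Finset.sum_apply]
    exact Finset.sum_congr rfl fun i hi => if_neg (ne_of_mem_of_not_mem hi hj)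
  have hXj : X j = fun x => h (x j) := funext fun x => if_pos rfl
  have hmh : Measurable fun x : ι → S => h (x j) := hh.comp (measurable_pi_apply j)
  have hmg : Measurable fun x : ι → S => ∑ i ∈ t, g (x i) :=
    Finset.measurable_fun_sum _ fun i _ => hg.comp (measurable_pi_apply i)
  have hindep := ((hind.indepFun_finsetSum_of_notMem
    (fun i => (hX i).comp (measurable_pi_apply i)) hj).symm).comp measurable_id
    (by fun_prop : Measurable fun r : ℝ≥0∞ => r ^ ρ)
  rw [hXsum, hXj] at hindep
  refine (lintegral_mul_eq_lintegral_mul_lintegral_of_indepFun'' hmh.aemeasurable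
    (hmg.pow_const ρ).aemeasurable hindep).trans_le ?_
  have hsum : ∫⁻ x, ∑ i ∈ t, g (x i) ∂Q = t.card * ∫⁻ s, g s ∂q := by
    rw [lintegral_finsetSum _ fun i _ => by fun_prop]
    simp_rw [Q, lintegral_pi_eval q _ hg]
    rw [Finset.sum_const, nsmul_eq_mul]
  rw [← hsum, ← lintegral_pi_eval q j hh]
  exact mul_le_mul_right (lintegral_rpow_le_rpow_lintegral Q hmg hρ hρ1) _

/-- The term `i = j` is separated from the others by the subadditivity of `t ↦ t ^ ρ`. -/
theorem lintegral_mul_rpow_mean_le {ρ : ℝ} (hρ : 0 < ρ) (hρ1 : ρ ≤ 1) {t : Finset ι} {j : ι}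
    (hj : j ∈ t) {h g : S → ℝ≥0∞} (hh : Measurable h) (hg : Measurable g) :
    ∫⁻ x, h (x j) * ((t.card : ℝ≥0∞)⁻¹ * ∑ i ∈ t, g (x i)) ^ ρ ∂Measure.pi (fun _ : ι => q)
      ≤ ((t.card : ℝ≥0∞)⁻¹) ^ ρ * ∫⁻ s, h s * g s ^ ρ ∂q
        + (∫⁻ s, h s ∂q) * (∫⁻ s, g s ∂q) ^ ρ := by
  classical
  have hcard : (t.card : ℝ≥0∞) ≠ 0 := by simpa using Finset.ne_empty_of_mem hj
  have hsplit : ∀ x : ι → S, h (x j) * ((t.card : ℝ≥0∞)⁻¹ * ∑ i ∈ t, g (x i)) ^ ρ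
      ≤ ((t.card : ℝ≥0∞)⁻¹) ^ ρ
        * (h (x j) * g (x j) ^ ρ + h (x j) * (∑ i ∈ t.erase j, g (x i)) ^ ρ) := fun x => by
    rw [← Finset.add_sum_erase _ _ hj, ENNReal.mul_rpow_of_nonneg _ _ hρ.le, mul_left_comm,
      ← mul_add]
    gcongr
    exact ENNReal.rpow_add_le_add_rpow _ _ hρ.le hρ1
  refine (lintegral_mono hsplit).trans ?_
  rw [lintegral_const_mul' _ _ (by finiteness), lintegral_add_left (by fun_prop), mul_add,
    lintegral_pi_eval q j (f := fun s => h s * g s ^ ρ) (by fun_prop)]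
  refine add_le_add le_rfl ?_
  calc ((t.card : ℝ≥0∞)⁻¹) ^ ρ * ∫⁻ x : ι → S,
        h (x j) * (∑ i ∈ t.erase j, g (x i)) ^ ρ ∂Measure.pi (fun _ : ι => q)
      ≤ ((t.card : ℝ≥0∞)⁻¹) ^ ρ * ((∫⁻ s, h s ∂q) * (t.card * ∫⁻ s, g s ∂q) ^ ρ) := by
        gcongr
        refine (lintegral_mul_rpow_sum_le q hρ hρ1 _ (Finset.notMem_erase j _) hh hg).trans ?_
        gcongr
        exact t.erase_subset j
    _ = (∫⁻ s, h s ∂q) * (∫⁻ s, g s ∂q) ^ ρ := by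
        rw [mul_left_comm, ← ENNReal.mul_rpow_of_nonneg _ _ hρ.le,
          ENNReal.inv_mul_cancel_left hcard (by simp)]

theorem exists_lintegral_le_of_forall {Ω J : Type*} [MeasurableSpace Ω] [MeasurableSpace J]
    [Countable J] [MeasurableSingletonClass J] {Q : Measure Ω} [IsProbabilityMeasure Q]
    {μ : Measure J} [IsProbabilityMeasure μ] {F : Ω → J → ℝ≥0∞}
    (hF : ∀ j, Measurable fun ω => F ω j) {T : ℝ≥0∞} (hT : ∀ j, ∫⁻ ω, F ω j ∂Q ≤ T) :
    ∃ ω, ∫⁻ j, F ω j ∂μ ≤ T := by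
  have hF' : Measurable (Function.uncurry F) := measurable_from_prod_countable_left hF
  obtain ⟨ω, hω⟩ := exists_le_lintegral (hF'.lintegral_prod_right (ν := μ)).aemeasurable (μ := Q)
  refine ⟨ω, hω.trans ?_⟩
  rw [lintegral_lintegral_swap hF'.aemeasurable]
  exact (lintegral_mono hT).trans_eq (by simp)

end ProductMeasure

section CountableOutput

variable {Ω Y : Type*} [MeasurableSpace Y] [Countable Y] [MeasurableSingletonClass Y]
  [MeasurableSpace Ω] {κ : Ω → Measure Y} {F : Ω → Y → ℝ≥0∞}

theorem tsum_measure_singleton (ν : Measure Y) [IsProbabilityMeasure ν] : ∑' y, ν {y} = 1 := by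
  simpa only [one_mul, lintegral_one, measure_univ] using
    (lintegral_countable' (μ := ν) fun _ => 1).symm

theorem measurable_lintegral_of_singleton (hκ : ∀ y, Measurable fun ω => κ ω {y})
    (hF : ∀ y, Measurable fun ω => F ω y) : Measurable fun ω => ∫⁻ y, F ω y ∂κ ω := by
  simp_rw [lintegral_countable']
  exact Measurable.tsum fun y => (hF y).mul (hκ y)

theorem lintegral_lintegral_eq_tsum (hκ : ∀ y, Measurable fun ω => κ ω {y})
    (hF : ∀ y, Measurable fun ω => F ω y) (μ : Measure Ω) :
    ∫⁻ ω, ∫⁻ y, F ω y ∂κ ω ∂μ = ∑' y, ∫⁻ ω, κ ω {y} * F ω y ∂μ := by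
  simp_rw [lintegral_countable', mul_comm (F _ _)]
  exact lintegral_tsum fun y => ((hκ y).mul (hF y)).aemeasurable

end CountableOutput

section InfoMoment

variable {S Y : Type*} [MeasurableSpace S] [MeasurableSpace Y]

/-- The moment of order `s` of the information density of the channel `K` with input law `q`. The
order `-ρ` measures how well the input can be decoded (it is Gallager's function up to a change of
parameters), the order `ρ` how well the output law can be simulated. -/
noncomputable def infoMoment (q : Measure S) (K : Kernel S Y) (s : ℝ) : ℝ≥0∞ :=
  ∫⁻ x, ∫⁻ y, infoDensity q K (x, y) ^ s ∂K x ∂q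

theorem infoDensity_rpow_neg {q : Measure S} [IsFiniteMeasure q] {K : Kernel S Y}
    [IsFiniteKernel K] (hK : ∀ x y, K x {y} ≠ 0) (p : S × Y) (ρ : ℝ) :
    infoDensity q K p ^ (-ρ) = ((K ∘ₘ q) {p.2} / K p.1 {p.2}) ^ ρ := by
  rw [ENNReal.rpow_neg, ← ENNReal.inv_rpow, infoDensity,
    ENNReal.inv_div (.inl (measure_ne_top _ _)) (.inr (hK _ _))]

variable [MeasurableSingletonClass Y]

theorem measurable_apply_singleton (K : Kernel S Y) (y : Y) : Measurable fun x => K x {y} :=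
  K.measurable_coe (measurableSet_singleton y)

theorem comp_apply_singleton (q : Measure S) (K : Kernel S Y) (y : Y) :
    (K ∘ₘ q) {y} = ∫⁻ x, K x {y} ∂q :=
  Measure.bind_apply (measurableSet_singleton y) K.measurable.aemeasurable

theorem measurable_infoDensity (q : Measure S) (K : Kernel S Y) (y : Y) :
    Measurable fun x => infoDensity q K (x, y) :=
  (measurable_apply_singleton K y).div_const ((K ∘ₘ q) {y})

theorem lintegral_infoDensity_eq_one (q : Measure S) [IsProbabilityMeasure q] {K : Kernel S Y}
    [IsMarkovKernel K] {y : Y} (hK : ∀ x, K x {y} ≠ 0) : ∫⁻ x, infoDensity q K (x, y) ∂q = 1 := by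
  simp_rw [infoDensity, div_eq_mul_inv]
  rw [lintegral_mul_const _ (measurable_apply_singleton K y), ← comp_apply_singleton]
  exact ENNReal.mul_inv_cancel (comp_singleton_ne_zero _ _ hK) (measure_ne_top _ _)

section Positive

variable {q : Measure S} [IsProbabilityMeasure q] {K : Kernel S Y} [IsMarkovKernel K]

theorem infoDensity_ne_top (hK : ∀ x y, K x {y} ≠ 0) (p : S × Y) : infoDensity q K p ≠ ∞ :=
  ENNReal.div_ne_top (measure_ne_top _ _) (comp_singleton_ne_zero _ _ fun x => hK x p.2)

variable {ι : Type*} [Fintype ι] {Kι : Kernel (ι → S) (ι → Y)}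

theorem infoDensity_pi (hKι : ∀ x, Kι x = Measure.pi fun i => K (x i))
    (hK : ∀ x y, K x {y} ≠ 0) (x : ι → S) (y : ι → Y) :
    infoDensity (Measure.pi fun _ => q) Kι (x, y) = ∏ i, infoDensity q K (x i, y i) := by
  have hout : (Kι ∘ₘ Measure.pi fun _ => q) {y} = ∏ i, (K ∘ₘ q) {y i} := by
    simp_rw [comp_apply_singleton, hKι, Measure.pi_singleton]
    exact lintegral_pi_prod _ fun i => measurable_apply_singleton K (y i)
  simp_rw [infoDensity]
  rw [hout, hKι, Measure.pi_singleton, ENNReal.prod_div_distrib]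
  exact fun i _ j _ _ => .inl (comp_singleton_ne_zero _ _ fun x => hK x _)

theorem infoMoment_pi [Countable Y] (hKι : ∀ x, Kι x = Measure.pi fun i => K (x i))
    (hK : ∀ x y, K x {y} ≠ 0) (s : ℝ) :
    infoMoment (Measure.pi fun _ => q) Kι s = infoMoment q K s ^ Fintype.card ι := by
  have hmeas : Measurable fun x => ∫⁻ y, infoDensity q K (x, y) ^ s ∂K x :=
    measurable_lintegral_of_singleton (measurable_apply_singleton K)
      fun y => (measurable_infoDensity q K y).pow_const s
  calc infoMoment (Measure.pi fun _ => q) Kι s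
      = ∫⁻ x, ∏ i, ∫⁻ y, infoDensity q K (x i, y) ^ s ∂K (x i) ∂Measure.pi fun _ : ι => q := by
        refine lintegral_congr fun x => ?_
        rw [hKι, ← lintegral_pi_prod _ fun i => .of_discrete]
        refine lintegral_congr fun y => ?_
        rw [infoDensity_pi hKι hK, ENNReal.prod_rpow_of_ne_top fun i _ => infoDensity_ne_top hK _]
    _ = ∏ _i : ι, infoMoment q K s :=
        lintegral_pi_prod (f := fun (_ : ι) x => ∫⁻ y, infoDensity q K (x, y) ^ s ∂K x) _
          fun _ => hmeas
    _ = infoMoment q K s ^ Fintype.card ι := by rw [Finset.prod_const, Finset.card_univ]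

end Positive

end InfoMoment

section RandomMeasurability

variable {ι S Y : Type*} [MeasurableSpace S] [MeasurableSpace Y]

/-- The density, with respect to the output law of the channel with input law `q`, of the output
law of the channel fed with a uniformly chosen codeword `x i`, `i ∈ t`. -/
noncomputable def meanDensity (q : Measure S) (K : Kernel S Y) (t : Finset ι) (x : ι → S) (y : Y) :
    ℝ≥0∞ :=
  (t.card : ℝ≥0∞)⁻¹ * ∑ i ∈ t, infoDensity q K (x i, y)

variable [MeasurableSingletonClass Y]

theorem measurable_meanDensity (q : Measure S) (K : Kernel S Y) (t : Finset ι) (y : Y) :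
    Measurable fun x : ι → S => meanDensity q K t x y :=
  (Finset.measurable_fun_sum _ fun i _ =>
    (measurable_infoDensity q K y).comp (measurable_pi_apply i)).const_mul _

variable [Fintype ι] [DecidableEq ι]

/-- The total likelihood, given the output `y`, of the codewords other than `x j`, relative to the
likelihood of `x j`: maximum likelihood decoding of `x j` can only fail if it is at least one. -/
noncomputable def confusion (K : Kernel S Y) (x : ι → S) (j : ι) (y : Y) : ℝ≥0∞ :=
  (∑ i ∈ Finset.univ.erase j, K (x i) {y}) / K (x j) {y}

theorem measurable_confusion (K : Kernel S Y) (j : ι) (y : Y) :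
    Measurable fun x : ι → S => confusion K x j y :=
  have hcoord : ∀ i, Measurable fun x : ι → S => K (x i) {y} := fun i =>
    (measurable_apply_singleton K y).comp (measurable_pi_apply i)
  (Finset.measurable_fun_sum _ fun i _ => hcoord i).div (hcoord j)

end RandomMeasurability

section RandomCodewords

variable {ι S Y : Type*} [MeasurableSpace S] [MeasurableSpace Y] [Countable Y]
  [MeasurableSingletonClass Y]

theorem measurable_lintegral_meanDensity_rpow (q : Measure S) (K : Kernel S Y) (t : Finset ι)
    (j : ι) (ρ : ℝ) : Measurable fun x : ι → S => ∫⁻ y, meanDensity q K t x y ^ ρ ∂K (x j) :=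
  measurable_lintegral_of_singleton
    (fun y => (measurable_apply_singleton K y).comp (measurable_pi_apply j))
    fun y => (measurable_meanDensity q K t y).pow_const ρ

variable [Fintype ι]

theorem measurable_lintegral_confusion_rpow [DecidableEq ι] (K : Kernel S Y) (j : ι) (ρ : ℝ) :
    Measurable fun x : ι → S => ∫⁻ y, confusion K x j y ^ ρ ∂K (x j) :=
  measurable_lintegral_of_singleton
    (fun y => (measurable_apply_singleton K y).comp (measurable_pi_apply j))
    fun y => (measurable_confusion K j y).pow_const ρ

variable (q : Measure S) [IsProbabilityMeasure q] {K : Kernel S Y} [IsMarkovKernel K] {ρ : ℝ}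

/-- Gallager's random coding bound. -/
theorem lintegral_confusion_rpow_le [DecidableEq ι] (hK : ∀ s y, K s {y} ≠ 0) (hρ : 0 < ρ)
    (hρ1 : ρ ≤ 1) (j : ι) :
    ∫⁻ x, ∫⁻ y, confusion K x j y ^ ρ ∂K (x j) ∂Measure.pi (fun _ : ι => q)
      ≤ (Fintype.card ι : ℝ≥0∞) ^ ρ * infoMoment q K (-ρ) := by
  have hK_meas := measurable_apply_singleton K
  rw [lintegral_lintegral_eq_tsum (fun y => (hK_meas y).comp (measurable_pi_apply j))
      fun y => (measurable_confusion K j y).pow_const ρ, infoMoment,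
    lintegral_lintegral_eq_tsum hK_meas fun y => (measurable_infoDensity q K y).pow_const (-ρ),
    ← ENNReal.tsum_mul_left]
  refine ENNReal.tsum_le_tsum fun y => ?_
  simp_rw [infoDensity_rpow_neg hK, confusion, div_eq_mul_inv,
    ENNReal.mul_rpow_of_nonneg _ _ hρ.le, mul_left_comm (K _ {y}),
    mul_comm (_ ^ ρ) (K _ {y} * _)]
  have hweight : Measurable fun s => K s {y} * ((K s {y})⁻¹) ^ ρ := by fun_prop
  refine (lintegral_mul_rpow_sum_le q hρ hρ1 _ (Finset.notMem_erase j _) hweight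
    (hK_meas y)).trans ?_
  rw [lintegral_mul_const _ hweight, mul_left_comm, ← ENNReal.mul_rpow_of_nonneg _ _ hρ.le,
    comp_apply_singleton]
  gcongr
  exact Finset.card_erase_le

/-- Soft covering: the mean of the output laws of independent codewords simulates the output law
of the channel. -/
theorem lintegral_meanDensity_rpow_le (hK : ∀ s y, K s {y} ≠ 0) (hρ : 0 < ρ) (hρ1 : ρ ≤ 1)
    {t : Finset ι} {j : ι} (hj : j ∈ t) :
    ∫⁻ x, ∫⁻ y, meanDensity q K t x y ^ ρ ∂K (x j) ∂Measure.pi (fun _ : ι => q)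
      ≤ ((t.card : ℝ≥0∞)⁻¹) ^ ρ * infoMoment q K ρ + 1 := by
  have hK_meas := measurable_apply_singleton K
  have hdens := measurable_infoDensity q K
  have hone : ∑' y, ∫⁻ s, K s {y} ∂q = 1 := by
    simp_rw [← comp_apply_singleton, tsum_measure_singleton]
  rw [lintegral_lintegral_eq_tsum (fun y => (hK_meas y).comp (measurable_pi_apply j))
      fun y => (measurable_meanDensity q K t y).pow_const ρ,
    infoMoment, lintegral_lintegral_eq_tsum hK_meas fun y => (hdens y).pow_const ρ,
    ← ENNReal.tsum_mul_left, ← hone, ← ENNReal.tsum_add]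
  refine ENNReal.tsum_le_tsum fun y =>
    (lintegral_mul_rpow_mean_le q hρ hρ1 hj (hK_meas y) (hdens y)).trans_eq ?_
  rw [lintegral_infoDensity_eq_one q fun s => hK s y, ENNReal.one_rpow, mul_one]

end RandomCodewords

section Codebook

variable {S Y : Type*} [MeasurableSpace S] [MeasurableSpace Y] {M L : ℕ}

/-- The stochastic encoder of the codebook `x`: the message `w` is sent to the codeword `x (w, l)`,
where `l` is uniformly random. -/
noncomputable def codebookEncoder (x : Fin M × Fin L → S) : Kernel (Fin M) S where
  toFun w := (Code.messageLaw L).map fun l => x (w, l)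
  measurable' := .of_discrete

instance [NeZero L] (x : Fin M × Fin L → S) : IsMarkovKernel (codebookEncoder x) :=
  ⟨fun _ => Measure.isProbabilityMeasure_map (Measurable.aemeasurable .of_discrete)⟩

theorem lintegral_codebookEncoder (x : Fin M × Fin L → S) (w : Fin M) {f : S → ℝ≥0∞}
    (hf : Measurable f) :
    ∫⁻ s, f s ∂codebookEncoder x w = ∫⁻ l, f (x (w, l)) ∂Code.messageLaw L :=
  lintegral_map hf .of_discrete

/-- The law of the index of the codeword sent with a codebook of `M` times `L` codewords. -/
noncomputable def indexLaw (M L : ℕ) : Measure (Fin M × Fin L) :=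
  (Code.messageLaw M).prod (Code.messageLaw L)

instance [NeZero M] [NeZero L] : IsProbabilityMeasure (indexLaw M L) := by
  rw [indexLaw]
  infer_instance

variable (x : Fin M × Fin L → S)

theorem lintegral_comp_codebookEncoder {f : S → ℝ≥0∞} (hf : Measurable f) :
    ∫⁻ s, f s ∂(codebookEncoder x ∘ₘ Code.messageLaw M) = ∫⁻ j, f (x j) ∂indexLaw M L := by
  rw [Measure.lintegral_bind (codebookEncoder x).aemeasurable hf.aemeasurable, indexLaw,
    lintegral_prod _ (Measurable.aemeasurable .of_discrete)]
  simp_rw [lintegral_codebookEncoder x _ hf]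

theorem comp_codebookEncoder_singleton [MeasurableSingletonClass Y] (K : Kernel S Y) (w : Fin M)
    (y : Y) :
    (K ∘ₖ codebookEncoder x) w {y} = (L : ℝ≥0∞)⁻¹ * ∑ l, K (x (w, l)) {y} := by
  rw [Kernel.comp_apply' _ _ _ (measurableSet_singleton y),
    lintegral_codebookEncoder _ _ (measurable_apply_singleton K y), lintegral_messageLaw]

/-- Maximum likelihood decoding of both indices, of which the message is kept. -/
noncomputable def mlDecoder [NeZero M] [NeZero L] (K : Kernel S Y) (y : Y) : Fin M :=
  (Finite.exists_max fun j : Fin M × Fin L => K (x j) {y}).choose.1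

theorem one_le_of_mlDecoder_ne [NeZero M] [NeZero L] {K : Kernel S Y} [IsMarkovKernel K]
    (hK : ∀ s y, K s {y} ≠ 0) {ρ : ℝ} (hρ : 0 ≤ ρ) {j : Fin M × Fin L} {y : Y}
    (hne : mlDecoder x K y ≠ j.1) :
    1 ≤ confusion K x j y ^ ρ := by
  obtain ⟨i, hi, hmax⟩ : ∃ i : Fin M × Fin L, i.1 = mlDecoder x K y ∧ K (x j) {y} ≤ K (x i) {y} :=
    ⟨_, rfl, (Finite.exists_max fun j : Fin M × Fin L => K (x j) {y}).choose_spec j⟩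
  have hij : i ≠ j := fun h => hne (by rw [← hi, h])
  rw [← ENNReal.one_rpow ρ]
  gcongr
  rw [confusion, ENNReal.le_div_iff_mul_le (.inl (hK _ _)) (.inl (measure_ne_top _ _)), one_mul]
  exact hmax.trans (Finset.single_le_sum (f := fun i => K (x i) {y}) (fun _ _ => zero_le)
    (Finset.mem_erase.2 ⟨hij, Finset.mem_univ i⟩))

variable [Countable Y] [MeasurableSingletonClass Y] [NeZero L] (K : Kernel S Y) [IsMarkovKernel K]

theorem lintegral_messageLaw_compProd_codebook (f : Fin M × Y → ℝ≥0∞) :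
    ∫⁻ p, f p ∂(Code.messageLaw M ⊗ₘ (K ∘ₖ codebookEncoder x))
      = ∫⁻ j, ∫⁻ y, f (j.1, y) ∂K (x j) ∂indexLaw M L := by
  rw [Measure.lintegral_compProd .of_discrete, indexLaw,
    lintegral_prod _ (Measurable.aemeasurable .of_discrete)]
  refine lintegral_congr fun w => ?_
  rw [Kernel.lintegral_comp _ _ _ .of_discrete, lintegral_codebookEncoder]
  exact Measurable.lintegral_kernel .of_discrete

variable [NeZero M] {ρ : ℝ}

theorem ofReal_mul_mutualInfo_codebook_add_one_le (q : Measure S) [IsProbabilityMeasure q]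
    (hK : ∀ s y, K s {y} ≠ 0) (hρ : 0 ≤ ρ) :
    ENNReal.ofReal ρ * mutualInfo (Code.messageLaw M ⊗ₘ (K ∘ₖ codebookEncoder x)) + 1
      ≤ ∫⁻ j, ∫⁻ y, meanDensity q K ({j.1} ×ˢ Finset.univ) x y ^ ρ ∂K (x j) ∂indexLaw M L := by
  refine (ofReal_mul_mutualInfo_add_one_le _ _ (K ∘ₘ q)
    (fun y => comp_singleton_ne_zero _ _ fun s => hK s y) hρ).trans_eq ?_
  rw [lintegral_messageLaw_compProd_codebook]
  refine lintegral_congr fun j => lintegral_congr fun y => ?_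
  rw [comp_codebookEncoder_singleton, meanDensity, Finset.sum_product, Finset.card_product]
  simp only [infoDensity, div_eq_mul_inv, ← Finset.sum_mul, mul_assoc, Finset.sum_singleton,
    Finset.card_singleton, one_mul, Finset.card_univ, Fintype.card_fin]

variable {K}

theorem measure_mlDecoder_ne_le (hK : ∀ s y, K s {y} ≠ 0) (hρ : 0 ≤ ρ) :
    (Code.messageLaw M ⊗ₘ (K ∘ₖ codebookEncoder x)) {p | mlDecoder x K p.2 ≠ p.1}
      ≤ ∫⁻ j, ∫⁻ y, confusion K x j y ^ ρ ∂K (x j) ∂indexLaw M L := by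
  rw [← lintegral_indicator_one .of_discrete, lintegral_messageLaw_compProd_codebook]
  gcongr with j y
  exact Set.indicator_le' (fun p hp => one_le_of_mlDecoder_ne x hK hρ hp) (fun _ _ => zero_le) _

theorem exists_codebook {Z : Type*} [MeasurableSpace Z] [Countable Z] [MeasurableSingletonClass Z]
    {K' : Kernel S Z} [IsMarkovKernel K'] (M L : ℕ) [NeZero M] [NeZero L]
    (hK : ∀ s y, K s {y} ≠ 0) (hK' : ∀ s z, K' s {z} ≠ 0) (q : Measure S) [IsProbabilityMeasure q]
    {φ : S → ℝ≥0∞} (hφ : Measurable φ) {c : ℝ≥0∞} (hc : c ≠ ∞) (hρ : 0 < ρ) (hρ1 : ρ ≤ 1) :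
    ∃ x : Fin M × Fin L → S,
      ∫⁻ s, φ s ∂(codebookEncoder x ∘ₘ Code.messageLaw M)
        + c * ((Code.messageLaw M ⊗ₘ (K ∘ₖ codebookEncoder x)) {p | mlDecoder x K p.2 ≠ p.1}
          + ENNReal.ofReal ρ * mutualInfo (Code.messageLaw M ⊗ₘ (K' ∘ₖ codebookEncoder x)))
      ≤ ∫⁻ s, φ s ∂q + c * ((M * L : ℝ≥0∞) ^ ρ * infoMoment q K (-ρ)
        + ((L : ℝ≥0∞)⁻¹) ^ ρ * infoMoment q K' ρ) := by
  have hφ_meas : ∀ j, Measurable fun x : Fin M × Fin L → S => φ (x j) := fun j =>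
    hφ.comp (measurable_pi_apply j)
  obtain ⟨x, hx⟩ := exists_lintegral_le_of_forall (μ := indexLaw M L)
    (Q := Measure.pi fun _ : Fin M × Fin L => q)
    (F := fun x j => φ (x j) + c * (∫⁻ y, confusion K x j y ^ ρ ∂K (x j)
      + ∫⁻ z, meanDensity q K' ({j.1} ×ˢ Finset.univ) x z ^ ρ ∂K' (x j)))
    (T := ∫⁻ s, φ s ∂q + c * ((M * L : ℝ≥0∞) ^ ρ * infoMoment q K (-ρ)
      + (((L : ℝ≥0∞)⁻¹) ^ ρ * infoMoment q K' ρ + 1)))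
    (fun j => (hφ_meas j).add
      (((measurable_lintegral_confusion_rpow K j ρ).add
        (measurable_lintegral_meanDensity_rpow q K' _ j ρ)).const_mul c))
    fun j => by
      rw [lintegral_add_left (hφ_meas j), lintegral_const_mul' _ _ hc,
        lintegral_add_left (measurable_lintegral_confusion_rpow K j ρ), lintegral_pi_eval q j hφ]
      gcongr
      · simpa using lintegral_confusion_rpow_le q hK hρ hρ1 j
      · simpa using lintegral_meanDensity_rpow_le q hK' hρ hρ1 (t := {j.1} ×ˢ Finset.univ)
          (j := j) (by simp)
  refine ⟨x, ?_⟩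
  rw [lintegral_add_left .of_discrete, lintegral_const_mul' _ _ hc,
    lintegral_add_left .of_discrete, ← add_assoc (_ * _), mul_add _ _ 1, mul_one, ← add_assoc] at hx
  rw [← ENNReal.add_le_add_iff_right hc, lintegral_comp_codebookEncoder x hφ]
  refine le_trans ?_ hx
  rw [add_assoc]
  nth_rw 2 [← mul_one c]
  rw [← mul_add, add_assoc]
  gcongr
  · exact measure_mlDecoder_ne_le x hK hρ.le
  · exact ofReal_mul_mutualInfo_codebook_add_one_le x K' q hK' hρ.le

end Codebook

section OnOff

variable {S Y : Type*} [MeasurableSpace S] [MeasurableSpace Y]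

/-- The law of an input that equals `on` with probability `p ≤ 1` and `off` otherwise. -/
noncomputable def onOffLaw (p : ℝ≥0) (on off : S) : Measure S :=
  (p : ℝ≥0∞) • Measure.dirac on + (1 - p : ℝ≥0∞) • Measure.dirac off

theorem isProbabilityMeasure_onOffLaw {p : ℝ≥0} (hp : p ≤ 1) (on off : S) :
    IsProbabilityMeasure (onOffLaw p on off) := by
  refine ⟨?_⟩
  simp only [onOffLaw, Measure.add_apply, Measure.smul_apply, measure_univ, smul_eq_mul, mul_one]
  exact add_tsub_cancel_of_le (mod_cast hp)

variable [MeasurableSingletonClass S]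

theorem lintegral_onOffLaw (p : ℝ≥0) (on off : S) (f : S → ℝ≥0∞) :
    ∫⁻ s, f s ∂onOffLaw p on off = p * f on + (1 - p) * f off := by
  simp only [onOffLaw, lintegral_add_measure, lintegral_smul_measure, lintegral_dirac, smul_eq_mul]

variable [MeasurableSingletonClass Y] {p : ℝ≥0} {K : Kernel S Y}

theorem comp_onOffLaw_singleton (p : ℝ≥0) (K : Kernel S Y) (on off : S) (y : Y) :
    (K ∘ₘ onOffLaw p on off) {y} = p * K on {y} + (1 - p) * K off {y} := by
  rw [comp_apply_singleton, lintegral_onOffLaw]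

variable [Countable Y]

theorem lintegral_div_rpow_le_one (μ ν : Measure Y) [IsProbabilityMeasure μ]
    [IsProbabilityMeasure ν] (hν : ∀ y, ν {y} ≠ 0) {ρ : ℝ} (hρ : 0 < ρ) (hρ1 : ρ ≤ 1) :
    ∫⁻ y, (μ {y} / ν {y}) ^ ρ ∂ν ≤ 1 := by
  refine (lintegral_rpow_le_rpow_lintegral ν .of_discrete hρ hρ1).trans_eq ?_
  simp_rw [lintegral_countable', ENNReal.div_mul_cancel (hν _) (measure_ne_top _ _),
    tsum_measure_singleton, ENNReal.one_rpow]

variable [IsMarkovKernel K] {ρ : ℝ}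

theorem infoMoment_neg_onOffLaw_le (hp : p ≤ 1) (on off : S) (hK : ∀ s y, K s {y} ≠ 0)
    (hρ : 0 < ρ) (hρ1 : ρ ≤ 1) :
    infoMoment (onOffLaw p on off) K (-ρ)
      ≤ p * (p ^ ρ + ∫⁻ y, (K off {y} / K on {y}) ^ ρ ∂K on) + (1 - p) := by
  have := isProbabilityMeasure_onOffLaw hp on off
  have h_on : ∀ y, ((K ∘ₘ onOffLaw p on off) {y} / K on {y}) ^ ρ
      ≤ p ^ ρ + (K off {y} / K on {y}) ^ ρ := fun y => by
    refine le_trans ?_ (ENNReal.rpow_add_le_add_rpow _ _ hρ.le hρ1)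
    rw [comp_onOffLaw_singleton, ENNReal.add_div,
      ENNReal.mul_div_cancel_right (hK _ _) (measure_ne_top _ _)]
    gcongr
    exact mul_le_of_le_one_left' tsub_le_self
  simp_rw [infoMoment, lintegral_onOffLaw, infoDensity_rpow_neg hK]
  gcongr
  · refine (lintegral_mono h_on).trans_eq ?_
    rw [lintegral_add_left .of_discrete, lintegral_const, measure_univ, mul_one]
  · exact mul_le_of_le_one_right' (lintegral_div_rpow_le_one _ _ (hK off) hρ hρ1)

theorem infoMoment_onOffLaw_le (hp : p < 1) (on off : S) (hK : ∀ s y, K s {y} ≠ 0)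
    (hρ : 0 ≤ ρ) :
    infoMoment (onOffLaw p on off) K ρ
      ≤ ((1 - p : ℝ≥0∞)⁻¹) ^ ρ * (p * ∫⁻ y, (K off {y} / K on {y}) ^ (-ρ) ∂K on + (1 - p)) := by
  have hp' : (1 - p : ℝ≥0∞) ≠ 0 := (tsub_pos_of_lt (mod_cast hp)).ne'
  have hdens : ∀ s y, infoDensity (onOffLaw p on off) K (s, y) ^ ρ
      ≤ ((1 - p : ℝ≥0∞)⁻¹) ^ ρ * (K off {y} / K s {y}) ^ (-ρ) := fun s y => by
    rw [ENNReal.rpow_neg, ← ENNReal.inv_rpow, ENNReal.inv_div (.inl (measure_ne_top _ _))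
      (.inl (hK _ _)), ← ENNReal.mul_rpow_of_nonneg _ _ hρ, infoDensity, div_eq_mul_inv,
      div_eq_mul_inv, mul_left_comm, ← ENNReal.mul_inv (.inl hp') (.inl (by finiteness)),
      comp_onOffLaw_singleton]
    gcongr
    exact le_add_self
  have hdens' : ∀ s, ∫⁻ y, infoDensity (onOffLaw p on off) K (s, y) ^ ρ ∂K s
      ≤ ((1 - p : ℝ≥0∞)⁻¹) ^ ρ * ∫⁻ y, (K off {y} / K s {y}) ^ (-ρ) ∂K s := fun s =>
    (lintegral_mono (hdens s)).trans_eq (lintegral_const_mul _ .of_discrete)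
  have h_off : ∫⁻ y, (K off {y} / K off {y}) ^ (-ρ) ∂K off = 1 := by
    simp only [ENNReal.div_self (hK _ _) (measure_ne_top _ _), ENNReal.one_rpow, lintegral_one,
      measure_univ]
  rw [infoMoment, lintegral_onOffLaw, mul_add, mul_left_comm, mul_comm _ (1 - p : ℝ≥0∞)]
  gcongr
  · exact hdens' on
  · simpa only [h_off, mul_one] using hdens' off

end OnOff

section Poisson

/-- The value of `∑ₖ P_b(k) (P_a(k) / P_b(k)) ^ s` for Poisson laws of means `b` and `a`. -/
noncomputable def chernoffPoisson (b a s : ℝ) : ℝ :=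
  Real.exp (b * ((a / b) ^ s - 1) + s * (b - a))

theorem chernoffPoisson_pos (b a s : ℝ) : 0 < chernoffPoisson b a s :=
  Real.exp_pos _

theorem poissonMeasure_singleton_div {a b : ℝ≥0} (hb : 0 < b) (k : ℕ) :
    poissonMeasure a {k} / poissonMeasure b {k}
      = ENNReal.ofReal (Real.exp (b - a) * (a / b) ^ k) := by
  have : (0 : ℝ) < b := hb
  rw [poissonMeasure_singleton, poissonMeasure_singleton,
    ← ENNReal.ofReal_div_of_pos (by positivity), Real.exp_sub, Real.exp_neg, Real.exp_neg, div_pow]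
  congr 1
  field_simp

/-- The integrand is a multiple of the mass function of the Poisson law of mean `b (a / b) ^ s`. -/
theorem lintegral_poissonMeasure_div_rpow {a b : ℝ≥0} (ha : 0 < a) (hb : 0 < b) (s : ℝ) :
    ∫⁻ k, (poissonMeasure a {k} / poissonMeasure b {k}) ^ s ∂poissonMeasure b
      = ENNReal.ofReal (chernoffPoisson b a s) := by
  have : (0 : ℝ) < a := ha
  have : (0 : ℝ) < b := hb
  have hterm : ∀ k, (poissonMeasure a {k} / poissonMeasure b {k}) ^ s * poissonMeasure b {k}
      = ENNReal.ofReal (chernoffPoisson b a s) * poissonMeasure (b * (a / b) ^ s) {k} := fun k => by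
    rw [poissonMeasure_singleton_div hb, ENNReal.ofReal_rpow_of_pos (by positivity),
      poissonMeasure_singleton, poissonMeasure_singleton, ← ENNReal.ofReal_mul (by positivity),
      ← ENNReal.ofReal_mul (chernoffPoisson_pos _ _ _).le]
    congr 1
    have hpow : (Real.exp (b - a) * (a / b : ℝ) ^ k) ^ s
        = Real.exp (s * (b - a)) * ((a / b : ℝ) ^ s) ^ k := by
      rw [Real.mul_rpow (by positivity) (by positivity), ← Real.exp_mul, mul_comm s,
        Real.rpow_pow_comm (by positivity)]
    have hexp : chernoffPoisson b a s
        = Real.exp (b * (a / b : ℝ) ^ s) * Real.exp (-b) * Real.exp (s * (b - a)) := by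
      rw [chernoffPoisson, ← Real.exp_add, ← Real.exp_add]
      ring_nf
    rw [hpow, hexp]
    push_cast
    rw [mul_pow, Real.exp_neg (b * (a / b : ℝ) ^ s)]
    field_simp
  simp_rw [lintegral_countable', hterm, ENNReal.tsum_mul_left, tsum_measure_singleton, mul_one]

variable {α lam Δ p : ℝ≥0} {ρ : ℝ}

theorem channel_singleton_ne_zero (α : ℝ≥0) (hlam : 0 < lam) (hΔ : 0 < Δ) (x : ℝ≥0) (k : ℕ) :
    channel α lam Δ x {k} ≠ 0 :=
  poissonMeasure_singleton_ne_zero (by positivity) k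

theorem lintegral_channel_div_rpow (α A : ℝ≥0) (hlam : 0 < lam) (hΔ : 0 < Δ) (s : ℝ) :
    ∫⁻ k, (channel α lam Δ 0 {k} / channel α lam Δ A {k}) ^ s ∂channel α lam Δ A
      = ENNReal.ofReal (chernoffPoisson ((α * A + lam) * Δ) (lam * Δ) s) := by
  refine (lintegral_poissonMeasure_div_rpow (a := (α * 0 + lam) * Δ) (b := (α * A + lam) * Δ)
    (by positivity) (by positivity) s).trans ?_
  push_cast
  rw [mul_zero, zero_add]

theorem one_sub_coe_eq_ofReal (p : ℝ≥0) : (1 - p : ℝ≥0∞) = ENNReal.ofReal (1 - p) := by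
  rw [ENNReal.ofReal_sub _ p.coe_nonneg, ENNReal.ofReal_one, ENNReal.ofReal_coe_nnreal]

theorem infoMoment_channel_neg_le (α A : ℝ≥0) (hlam : 0 < lam) (hΔ : 0 < Δ) (hp : p ≤ 1)
    (hρ : 0 < ρ) (hρ1 : ρ ≤ 1) :
    infoMoment (onOffLaw p A 0) (channel α lam Δ) (-ρ)
      ≤ ENNReal.ofReal (Real.exp
        (-(p * (1 - chernoffPoisson ((α * A + lam) * Δ) (lam * Δ) ρ - (p : ℝ) ^ ρ)))) := by
  refine (infoMoment_neg_onOffLaw_le hp A 0 (channel_singleton_ne_zero α hlam hΔ) hρ hρ1).trans ?_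
  have hB := chernoffPoisson_pos ((α * A + lam) * Δ) (lam * Δ) ρ
  rw [lintegral_channel_div_rpow α A hlam hΔ]
  set B := chernoffPoisson ((α * A + lam) * Δ) (lam * Δ) ρ
  have hp' : (0 : ℝ) ≤ 1 - p := sub_nonneg.2 hp
  rw [one_sub_coe_eq_ofReal, ← ENNReal.ofReal_coe_nnreal,
    ENNReal.ofReal_rpow_of_nonneg p.coe_nonneg hρ.le, ← ENNReal.ofReal_add (by positivity) hB.le,
    ← ENNReal.ofReal_mul p.coe_nonneg, ← ENNReal.ofReal_add (by positivity) hp']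
  refine ENNReal.ofReal_le_ofReal (le_trans (le_of_eq ?_) (Real.add_one_le_exp _))
  ring

theorem infoMoment_channel_le (α A : ℝ≥0) (hlam : 0 < lam) (hΔ : 0 < Δ) (hp : p < 1)
    (hρ : 0 ≤ ρ) :
    infoMoment (onOffLaw p A 0) (channel α lam Δ) ρ
      ≤ ENNReal.ofReal (Real.exp
        (ρ * (p / (1 - p)) + p * (chernoffPoisson ((α * A + lam) * Δ) (lam * Δ) (-ρ) - 1))) := by
  refine (infoMoment_onOffLaw_le hp A 0 (channel_singleton_ne_zero α hlam hΔ) hρ).trans ?_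
  have hB := chernoffPoisson_pos ((α * A + lam) * Δ) (lam * Δ) (-ρ)
  rw [lintegral_channel_div_rpow α A hlam hΔ]
  set B := chernoffPoisson ((α * A + lam) * Δ) (lam * Δ) (-ρ)
  have hp' : (0 : ℝ) < 1 - p := sub_pos.2 hp
  have hbase : ((1 - p : ℝ)⁻¹) ^ ρ ≤ Real.exp (ρ * (p / (1 - p))) := by
    rw [mul_comm ρ, Real.exp_mul]
    refine Real.rpow_le_rpow (by positivity) (le_trans (le_of_eq ?_) (Real.add_one_le_exp _)) hρ
    field_simp
    ring
  rw [one_sub_coe_eq_ofReal, ← ENNReal.ofReal_coe_nnreal, ← ENNReal.ofReal_inv_of_pos hp',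
    ENNReal.ofReal_rpow_of_nonneg (by positivity) hρ, ← ENNReal.ofReal_mul p.coe_nonneg,
    ← ENNReal.ofReal_add (by positivity) hp'.le, ← ENNReal.ofReal_mul (by positivity), Real.exp_add]
  refine ENNReal.ofReal_le_ofReal (mul_le_mul hbase ?_ (by positivity) (Real.exp_pos _).le)
  refine le_trans (le_of_eq ?_) (Real.add_one_le_exp _)
  ring

end Poisson

section OnOffCodes

variable {n M L : ℕ} [NeZero M] [NeZero L] {αB lB αE lE Δ A p E : ℝ≥0} {ρ : ℝ}

/-- The code that sends a message to a random codeword of the codebook `x` and is decoded by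
maximum likelihood. -/
noncomputable def codebookCode (αB lB Δ : ℝ≥0) (x : Fin M × Fin L → Fin n → ℝ≥0) : Code n M where
  encoder := codebookEncoder x
  isMarkovKernel := inferInstance
  decoder := mlDecoder x (channelN αB lB Δ n)

theorem infoMoment_channelN (q : Measure ℝ≥0) [IsProbabilityMeasure q] {α lam : ℝ≥0}
    (hlam : 0 < lam) (hΔ : 0 < Δ) (n : ℕ) (s : ℝ) :
    infoMoment (Measure.pi fun _ => q) (channelN α lam Δ n) s
      = infoMoment q (channel α lam Δ) s ^ n := by
  rw [infoMoment_pi (K := channel α lam Δ) (fun _ => rfl) (channel_singleton_ne_zero α hlam hΔ),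
    Fintype.card_fin]

theorem lintegral_sum_onOffLaw (hp : p ≤ 1) (n : ℕ) :
    ∫⁻ x, ∑ i, (x i : ℝ≥0∞) ∂Measure.pi (fun _ : Fin n => onOffLaw p A 0) = n * (p * A) := by
  have := isProbabilityMeasure_onOffLaw hp A 0
  rw [lintegral_finsetSum _ fun i _ => by fun_prop]
  simp_rw [lintegral_pi_eval (onOffLaw p A 0) _ measurable_coe_nnreal_ennreal, lintegral_onOffLaw]
  simp

theorem exists_code_intensity_add_le (αB αE A : ℝ≥0) (n M L : ℕ) [NeZero M] [NeZero L]
    (hlB : 0 < lB) (hlE : 0 < lE) (hΔ : 0 < Δ) (hp : p < 1) (hρ : 0 < ρ) (hρ1 : ρ ≤ 1)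
    {c : ℝ≥0∞} (hc : c ≠ ∞) :
    ∃ C : Code n M, ∑ i, ∫⁻ x, (x i : ℝ≥0∞) ∂C.inputLaw
        + c * (C.errorProb αB lB Δ + ENNReal.ofReal ρ * C.leakage αE lE Δ)
      ≤ n * (p * A)
        + c * ((M * L : ℝ≥0∞) ^ ρ * infoMoment (onOffLaw p A 0) (channel αB lB Δ) (-ρ) ^ n
          + ((L : ℝ≥0∞)⁻¹) ^ ρ * infoMoment (onOffLaw p A 0) (channel αE lE Δ) ρ ^ n) := by
  have := isProbabilityMeasure_onOffLaw hp.le A 0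
  obtain ⟨x, hx⟩ := exists_codebook M L (channelN_singleton_ne_zero (α := αB) (n := n) hlB hΔ)
    (channelN_singleton_ne_zero (α := αE) hlE hΔ) (Measure.pi fun _ => onOffLaw p A 0)
    (φ := fun x => ∑ i, (x i : ℝ≥0∞)) (by fun_prop) hc hρ hρ1
  rw [lintegral_sum_onOffLaw hp.le, infoMoment_channelN _ hlB hΔ, infoMoment_channelN _ hlE hΔ,
    lintegral_finsetSum _ fun i _ => by fun_prop] at hx
  exact ⟨codebookCode αB lB Δ x, hx⟩

/-- The weight given to the error probability and the leakage in the average over the codebooks is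
so small that they cannot push the average intensity above `E`. -/
theorem exists_code_meetsAverage {T : ℝ≥0∞} (hT0 : T ≠ 0) (hT : T ≠ ∞) (hlB : 0 < lB)
    (hlE : 0 < lE) (hΔ : 0 < Δ) (hp : p < 1) (hpE : p * A < E) (hρ : 0 < ρ) (hρ1 : ρ ≤ 1)
    (hle : (M * L : ℝ≥0∞) ^ ρ * infoMoment (onOffLaw p A 0) (channel αB lB Δ) (-ρ) ^ n
      + ((L : ℝ≥0∞)⁻¹) ^ ρ * infoMoment (onOffLaw p A 0) (channel αE lE Δ) ρ ^ n ≤ T) :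
    ∃ C : Code n M, C.MeetsAverage E ∧ (n ≠ 0 →
      C.errorProb αB lB Δ + ENNReal.ofReal ρ * C.leakage αE lE Δ ≤ E / (E - p * A) * T) := by
  have hη : (E - p * A : ℝ≥0∞) ≠ 0 := (tsub_pos_of_lt (mod_cast hpE)).ne'
  obtain ⟨C, hC⟩ := exists_code_intensity_add_le αB αE A n M L hlB hlE hΔ hp hρ hρ1
    (c := n * ((E - p * A) / T)) (by finiteness)
  have hbudget : ∑ i, ∫⁻ x, (x i : ℝ≥0∞) ∂C.inputLaw + n * ((E - p * A) / T)
      * (C.errorProb αB lB Δ + ENNReal.ofReal ρ * C.leakage αE lE Δ) ≤ n * E := by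
    refine (hC.trans (add_le_add_right (mul_le_mul_right hle _) _)).trans_eq ?_
    rw [mul_assoc, ENNReal.div_mul_cancel hT0 hT, ← mul_add,
      add_tsub_cancel_of_le (mod_cast hpE.le)]
  refine ⟨C, le_self_add.trans hbudget, fun hn => ?_⟩
  have hweighted := le_add_self.trans hbudget
  rw [mul_assoc, ENNReal.mul_le_mul_iff_right (mod_cast hn) (ENNReal.natCast_ne_top n)] at hweighted
  calc C.errorProb αB lB Δ + ENNReal.ofReal ρ * C.leakage αE lE Δ
      ≤ E / ((E - p * A) / T) := by
        rwa [ENNReal.le_div_iff_mul_le (.inl (ENNReal.div_pos hη hT).ne') (.inl (by finiteness)),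
          mul_comm]
    _ = E / (E - p * A) * T := by
        rw [div_eq_mul_inv, ENNReal.inv_div (.inl hT) (.inl hT0), ← mul_div_assoc,
          ENNReal.mul_div_right_comm]

theorem isSecureRate_of_forall_exists_code {R : ℝ≥0} (hρ : 0 < ρ) {T : ℕ → ℝ≥0∞}
    (hT : Tendsto T atTop (𝓝 0))
    (hC : ∀ n : ℕ, ∃ C : Code n ⌈Real.exp (n * Δ * R)⌉₊, C.MeetsAverage E ∧ (n ≠ 0 →
      C.errorProb αB lB Δ + ENNReal.ofReal ρ * C.leakage αE lE Δ ≤ T n)) :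
    IsSecureRate αB lB αE lE Δ E R := by
  choose C hE hle using hC
  have hρ' : ENNReal.ofReal ρ ≠ 0 := by simpa using hρ
  have hlim : Tendsto (fun n => T n / ENNReal.ofReal ρ) atTop (𝓝 0) := by
    simpa using ENNReal.Tendsto.div_const hT (.inr hρ')
  refine ⟨C, hE, ?_, ?_⟩
  · refine tendsto_of_tendsto_of_tendsto_of_le_of_le' tendsto_const_nhds hT
      (.of_forall fun _ => zero_le) ?_
    filter_upwards [eventually_ne_atTop 0] with n hn
    exact le_self_add.trans (hle n hn)
  · refine tendsto_of_tendsto_of_tendsto_of_le_of_le' tendsto_const_nhds hlim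
      (.of_forall fun _ => zero_le) ?_
    filter_upwards [eventually_ne_atTop 0] with n hn
    calc (C n).leakage αE lE Δ / n ≤ (C n).leakage αE lE Δ :=
          ENNReal.div_le_of_le_mul
            (le_mul_of_one_le_right zero_le (mod_cast Nat.one_le_iff_ne_zero.2 hn))
      _ ≤ T n / ENNReal.ofReal ρ := by
          rw [ENNReal.le_div_iff_mul_le (.inl hρ') (.inl ENNReal.ofReal_ne_top), mul_comm]
          exact le_add_self.trans (hle n hn)

end OnOffCodes

section Exponents

theorem ceil_exp_mul_ceil_exp_rpow_le {a b ρ : ℝ} (ha : 0 ≤ a) (hb : 0 ≤ b) (hρ : 0 ≤ ρ) :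
    (⌈Real.exp a⌉₊ * ⌈Real.exp b⌉₊ : ℝ≥0∞) ^ ρ
      ≤ ENNReal.ofReal (4 ^ ρ * Real.exp (ρ * (a + b))) := by
  have hceil : ∀ {x : ℝ}, 0 ≤ x → (⌈Real.exp x⌉₊ : ℝ≥0∞) ≤ ENNReal.ofReal (2 * Real.exp x) :=
    fun {x} hx => by
      rw [← ENNReal.ofReal_natCast]
      refine ENNReal.ofReal_le_ofReal ?_
      linarith [Nat.ceil_lt_add_one (Real.exp_pos x).le, Real.one_le_exp hx]
  calc (⌈Real.exp a⌉₊ * ⌈Real.exp b⌉₊ : ℝ≥0∞) ^ ρ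
      ≤ (ENNReal.ofReal (2 * Real.exp a) * ENNReal.ofReal (2 * Real.exp b)) ^ ρ := by
        gcongr
        exacts [hceil ha, hceil hb]
    _ = ENNReal.ofReal (4 ^ ρ * Real.exp (ρ * (a + b))) := by
        rw [← ENNReal.ofReal_mul (by positivity), mul_mul_mul_comm, ← Real.exp_add,
          ENNReal.ofReal_rpow_of_nonneg (by positivity) hρ,
          Real.mul_rpow (by norm_num) (Real.exp_pos _).le, ← Real.exp_mul, mul_comm ρ]
        norm_num

theorem inv_ceil_exp_rpow_le (b : ℝ) {ρ : ℝ} (hρ : 0 ≤ ρ) :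
    ((⌈Real.exp b⌉₊ : ℝ≥0∞)⁻¹) ^ ρ ≤ ENNReal.ofReal (Real.exp (-(ρ * b))) := by
  rw [← mul_neg, mul_comm, Real.exp_mul, ← ENNReal.ofReal_rpow_of_nonneg (Real.exp_pos _).le hρ,
    Real.exp_neg, ENNReal.ofReal_inv_of_pos (Real.exp_pos _), ← ENNReal.ofReal_natCast]
  gcongr
  exact Nat.le_ceil _

theorem ofReal_exp_pow (a : ℝ) (n : ℕ) :
    ENNReal.ofReal (Real.exp a) ^ n = ENNReal.ofReal (Real.exp (n * a)) := by
  rw [← ENNReal.ofReal_pow (Real.exp_pos _).le, ← Real.exp_nat_mul]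

theorem tendsto_ofReal_mul_exp_neg (K : ℝ) {γ : ℝ} (hγ : 0 < γ) :
    Tendsto (fun n : ℕ => ENNReal.ofReal (K * Real.exp (-(n * γ)))) atTop (𝓝 0) := by
  have hexp : Tendsto (fun n : ℕ => Real.exp (-(n * γ))) atTop (𝓝 0) :=
    Real.tendsto_exp_neg_atTop_nhds_zero.comp (tendsto_natCast_atTop_atTop.atTop_mul_const hγ)
  simpa using ENNReal.tendsto_ofReal (hexp.const_mul K)

/-- The codebook rate `RL` of the local randomness is the midpoint between the rate needed for
secrecy and the largest rate that can be decoded, so that both exponents equal `γ`. -/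
theorem isSecureRate_of_exponents {αB lB αE lE Δ E R A p : ℝ≥0} {ρ x y : ℝ} (hlB : 0 < lB)
    (hlE : 0 < lE) (hΔ : 0 < Δ) (hρ : 0 < ρ) (hρ1 : ρ ≤ 1) (hp : p < 1) (hpE : p * A < E)
    (hrel : infoMoment (onOffLaw p A 0) (channel αB lB Δ) (-ρ) ≤ ENNReal.ofReal (Real.exp (-x)))
    (hsec : infoMoment (onOffLaw p A 0) (channel αE lE Δ) ρ ≤ ENNReal.ofReal (Real.exp y))
    (hy : 0 ≤ y) (hxy : y + ρ * (Δ * R) < x) :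
    IsSecureRate αB lB αE lE Δ E R := by
  set γ := (x - ρ * (Δ * R) - y) / 2 with hγ
  have hγ0 : 0 < γ := by linarith
  set RL := (y + γ) / ρ
  have hRL_mul : ρ * RL = y + γ := mul_div_cancel₀ _ hρ.ne'
  have hη : (E - p * A : ℝ≥0∞) ≠ 0 := (tsub_pos_of_lt (mod_cast hpE)).ne'
  have hlim := ENNReal.Tendsto.const_mul (a := E / (E - p * A : ℝ≥0∞))
    (tendsto_ofReal_mul_exp_neg (4 ^ ρ + 1) hγ0) (.inr (by finiteness))
  rw [mul_zero] at hlim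
  refine isSecureRate_of_forall_exists_code hρ hlim fun n => exists_code_meetsAverage
    (L := ⌈Real.exp (n * RL)⌉₊) (ENNReal.ofReal_pos.2 (by positivity)).ne' ENNReal.ofReal_ne_top
    hlB hlE hΔ hp hpE hρ hρ1 ?_
  have hrel_n : (⌈Real.exp (n * Δ * R)⌉₊ * ⌈Real.exp (n * RL)⌉₊ : ℝ≥0∞) ^ ρ
      * infoMoment (onOffLaw p A 0) (channel αB lB Δ) (-ρ) ^ n
      ≤ ENNReal.ofReal (4 ^ ρ * Real.exp (-(n * γ))) := by
    refine (mul_le_mul' (ceil_exp_mul_ceil_exp_rpow_le (by positivity) (by positivity) hρ.le)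
      (pow_le_pow_left' hrel n)).trans_eq ?_
    rw [ofReal_exp_pow, ← ENNReal.ofReal_mul (by positivity), mul_assoc, ← Real.exp_add]
    congr 3
    linear_combination (n : ℝ) * hRL_mul - 2 * (n : ℝ) * hγ
  have hsec_n : ((⌈Real.exp (n * RL)⌉₊ : ℝ≥0∞)⁻¹) ^ ρ
      * infoMoment (onOffLaw p A 0) (channel αE lE Δ) ρ ^ n
      ≤ ENNReal.ofReal (Real.exp (-(n * γ))) := by
    refine (mul_le_mul' (inv_ceil_exp_rpow_le _ hρ.le) (pow_le_pow_left' hsec n)).trans_eq ?_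
    rw [ofReal_exp_pow, ← ENNReal.ofReal_mul (by positivity), ← Real.exp_add]
    congr 2
    linear_combination -(n : ℝ) * hRL_mul
  refine (add_le_add hrel_n hsec_n).trans_eq ?_
  rw [← ENNReal.ofReal_add (by positivity) (by positivity), add_mul, one_mul]

end Exponents

section Gain

theorem one_le_chernoffPoisson_neg {a b ρ : ℝ} (ha : 0 < a) (hb : 0 < b) (hρ : 0 ≤ ρ) :
    1 ≤ chernoffPoisson b a (-ρ) := by
  have hlog : 1 - a / b ≤ Real.log (b / a) := by
    simpa using Real.one_sub_inv_le_log_of_pos (div_pos hb ha)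
  have hrpow : ρ * (1 - a / b) ≤ (a / b) ^ (-ρ) - 1 := by
    calc ρ * (1 - a / b) ≤ ρ * Real.log (b / a) := by gcongr
      _ ≤ Real.exp (ρ * Real.log (b / a)) - 1 := by
        linarith [Real.add_one_le_exp (ρ * Real.log (b / a))]
      _ = (a / b) ^ (-ρ) - 1 := by
        rw [Real.rpow_neg (by positivity), ← Real.inv_rpow (by positivity), inv_div,
          Real.rpow_def_of_pos (by positivity), mul_comm]
  have hdiff : b * (ρ * (1 - a / b)) = ρ * (b - a) := by field_simp
  exact Real.one_le_exp (by linarith [mul_le_mul_of_nonneg_left hrpow hb.le])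

theorem chernoffPoisson_zero (b a : ℝ) : chernoffPoisson b a 0 = 1 := by
  simp [chernoffPoisson]

theorem hasDerivAt_chernoffPoisson {a b : ℝ} (ha : 0 < a) (hb : 0 < b) :
    HasDerivAt (chernoffPoisson b a) (b * Real.log (a / b) + (b - a)) 0 := by
  have hrpow : HasDerivAt (fun s : ℝ => (a / b) ^ s) (Real.log (a / b)) 0 := by
    simpa using (hasDerivAt_id (0 : ℝ)).const_rpow (div_pos ha hb)
  have hexponent : HasDerivAt (fun s : ℝ => b * ((a / b) ^ s - 1) + s * (b - a))
      (b * Real.log (a / b) + (b - a)) 0 :=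
    (((hrpow.sub_const 1).const_mul b).add ((hasDerivAt_id (0 : ℝ)).mul_const (b - a))).congr_deriv
      (by simp)
  exact hexponent.exp.congr_deriv (by simp)

theorem hasDerivAt_chernoffPoisson_add {u l Δ : ℝ} (hu : 0 ≤ u) (hl : 0 < l) (hΔ : 0 < Δ) :
    HasDerivAt (chernoffPoisson ((u + l) * Δ) (l * Δ))
      (Δ * (u - (u + l) * Real.log (1 + u / l))) 0 := by
  refine (hasDerivAt_chernoffPoisson (by positivity) (by positivity)).congr_deriv ?_
  have hratio : l * Δ / ((u + l) * Δ) = (1 + u / l)⁻¹ := by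
    field_simp
    ring
  rw [hratio, Real.log_inv]
  ring

theorem tendsto_div_mul_log_one_add_div_sub_log {l : ℝ} (hl : 0 < l) :
    Tendsto (fun u : ℝ => (u + l) / u * Real.log (1 + u / l) - Real.log u) atTop
      (𝓝 (-Real.log l)) := by
  have hlog : Tendsto (fun u : ℝ => Real.log u / u) atTop (𝓝 0) :=
    Real.isLittleO_log_id_atTop.tendsto_div_nhds_zero
  have hlog_inv : Tendsto (fun u : ℝ => Real.log (u⁻¹ + l⁻¹)) atTop (𝓝 (-Real.log l)) := by
    simpa using (tendsto_inv_atTop_zero.add_const l⁻¹).log (by simpa using hl.ne')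
  have hlim := hlog_inv.add ((hlog.add (hlog_inv.mul tendsto_inv_atTop_zero)).const_mul l)
  rw [mul_zero, add_zero, mul_zero, add_zero] at hlim
  refine hlim.congr' ?_
  filter_upwards [eventually_gt_atTop 0] with u hu
  have hsplit : 1 + u / l = u * (u⁻¹ + l⁻¹) := by field_simp
  rw [hsplit, Real.log_mul hu.ne' (by positivity)]
  field_simp
  ring

theorem eventually_lt_gain {lB lE Δ t : ℝ} (hlB : 0 < lB) (hlE : 0 < lE) (hΔ : 0 < Δ)
    (ht : t < Real.log (lE / lB)) :
    ∀ᶠ u : ℝ in atTop, 1 + Δ * (t * u)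
      < Δ * ((u + lB) * Real.log (1 + u / lB) - (u + lE) * Real.log (1 + u / lE)) := by
  have hlim := ((tendsto_div_mul_log_one_add_div_sub_log hlB).sub
    (tendsto_div_mul_log_one_add_div_sub_log hlE)).sub (tendsto_inv_atTop_zero.mul_const Δ⁻¹)
  have hval : -Real.log lB - -Real.log lE - 0 * Δ⁻¹ = Real.log (lE / lB) := by
    rw [Real.log_div hlE.ne' hlB.ne']
    ring
  rw [hval] at hlim
  filter_upwards [hlim.eventually (lt_mem_nhds ht), eventually_gt_atTop 0] with u hu hu0
  generalize Real.log (1 + u / lB) = logB, Real.log (1 + u / lE) = logE at hu ⊢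
  have hscaled := mul_lt_mul_of_pos_right hu (mul_pos hΔ hu0)
  field_simp at hscaled
  linarith

theorem exists_exponent_lt {lB lE Δ g u : ℝ} (hlB : 0 < lB) (hlE : 0 < lE) (hΔ : 0 < Δ)
    (hu : 0 ≤ u)
    (hg : g < Δ * ((u + lB) * Real.log (1 + u / lB) - (u + lE) * Real.log (1 + u / lE))) :
    ∃ ρ : ℝ, 0 < ρ ∧ ρ ≤ 1 ∧ ρ * g < (1 - chernoffPoisson ((u + lB) * Δ) (lB * Δ) ρ)
      + (1 - chernoffPoisson ((u + lE) * Δ) (lE * Δ) (-ρ)) := by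
  have hB := hasDerivAt_chernoffPoisson_add hu hlB hΔ
  have hE := hasDerivAt_chernoffPoisson_add hu hlE hΔ
  rw [← neg_zero] at hE
  have hderiv := (hB.neg.sub (hE.comp 0 (hasDerivAt_neg (0 : ℝ)))).congr_deriv (g' :=
    Δ * ((u + lB) * Real.log (1 + u / lB) - (u + lE) * Real.log (1 + u / lE))) (by ring)
  obtain ⟨ρ, hslope, hρ, hρ1⟩ := ((hderiv.tendsto_slope_zero_right.eventually
    (lt_mem_nhds hg)).and (Ioc_mem_nhdsGT (zero_lt_one (α := ℝ)))).exists
  refine ⟨ρ, hρ, hρ1, ?_⟩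
  simp only [zero_add, Pi.sub_apply, Pi.neg_apply, Function.comp_apply, neg_zero,
    chernoffPoisson_zero, smul_eq_mul] at hslope
  rw [inv_mul_eq_div, lt_div_iff₀ hρ] at hslope
  linarith

variable {α lB lE Δ c : ℝ≥0}

theorem exists_intensity_exponent_lt (hα : 0 < α) (hlB : 0 < lB) (hlE : 0 < lE) (hΔ : 0 < Δ)
    (hc : c < α * Real.log (lE / lB)) :
    ∃ A : ℝ≥0, 0 < A ∧ ∃ ρ : ℝ, 0 < ρ ∧ ρ ≤ 1 ∧ ρ * (1 + Δ * (c * A))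
      < (1 - chernoffPoisson ((α * A + lB) * Δ) (lB * Δ) ρ)
        + (1 - chernoffPoisson ((α * A + lE) * Δ) (lE * Δ) (-ρ)) := by
  have hα' : (0 : ℝ) < α := hα
  have hc' : (c : ℝ) / α < Real.log (lE / lB) := by rwa [div_lt_iff₀' hα']
  have hscale : Tendsto (fun A : ℝ≥0 => (α * A : ℝ)) atTop atTop :=
    (NNReal.tendsto_coe_atTop.2 tendsto_id).const_mul_atTop hα'
  obtain ⟨A, hA, hA0⟩ := ((hscale.eventually (eventually_lt_gain (lB := (lB : ℝ))
    (lE := (lE : ℝ)) (Δ := (Δ : ℝ)) hlB hlE hΔ hc')).and (eventually_gt_atTop 0)).exists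
  have hcancel : (c : ℝ) / α * (α * A) = c * A := by field_simp
  exact ⟨A, hA0, exists_exponent_lt hlB hlE hΔ (by positivity) (hcancel ▸ hA)⟩

/-- To first order in the duty cycle `p`, both sides are linear in `p`. -/
theorem eventually_onOff_exponent_lt {ρ g x y : ℝ} (hρ : 0 < ρ) (hg : ρ * (1 + g) < x - y) :
    ∀ᶠ p : ℝ in 𝓝[>] 0, ρ * (p / (1 - p)) + p * y + ρ * (g * p) < p * (x - p ^ ρ) := by
  have hcont : ContinuousAt (fun p : ℝ => ρ / (1 - p) + y + ρ * g - (x - p ^ ρ)) 0 := by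
    have hrpow : ContinuousAt (fun p : ℝ => p ^ ρ) 0 :=
      Real.continuousAt_rpow_const _ _ (.inr hρ.le)
    have hdiv : ContinuousAt (fun p : ℝ => ρ / (1 - p)) 0 :=
      continuousAt_const.div (by fun_prop) (by simp)
    fun_prop
  have hneg : ρ / (1 - 0) + y + ρ * g - (x - (0 : ℝ) ^ ρ) < 0 := by
    rw [Real.zero_rpow hρ.ne', sub_zero, sub_zero, div_one]
    linarith
  filter_upwards [(hcont.eventually (gt_mem_nhds hneg)).filter_mono nhdsWithin_le_nhds,
    self_mem_nhdsWithin] with p hp hp0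
  rw [← sub_neg]
  calc _ = p * (ρ / (1 - p) + y + ρ * g - (x - p ^ ρ)) := by ring
    _ < 0 := mul_neg_of_pos_of_neg hp0 hp

theorem isSecureRate_of_onOff_exponent_lt {E R A p : ℝ≥0} {ρ : ℝ} (hlB : 0 < lB) (hlE : 0 < lE)
    (hΔ : 0 < Δ) (hρ : 0 < ρ) (hρ1 : ρ ≤ 1) (hp : p < 1) (hpA : p * A < E)
    (hexponent : ρ * (p / (1 - p)) + p * (chernoffPoisson ((α * A + lE) * Δ) (lE * Δ) (-ρ) - 1)
      + ρ * (Δ * R) < p * ((1 - chernoffPoisson ((α * A + lB) * Δ) (lB * Δ) ρ) - (p : ℝ) ^ ρ)) :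
    IsSecureRate α lB α lE Δ E R := by
  have hK := mul_nonneg p.coe_nonneg (sub_nonneg.2 (one_le_chernoffPoisson_neg
    (a := lE * Δ) (b := (α * A + lE) * Δ) (by positivity) (by positivity) hρ.le))
  have hp' : 0 ≤ 1 - (p : ℝ) := sub_nonneg.2 (NNReal.coe_le_one.2 hp.le)
  exact isSecureRate_of_exponents hlB hlE hΔ hρ hρ1 hp hpA
    (infoMoment_channel_neg_le α A hlB hΔ hp.le hρ hρ1)
    (infoMoment_channel_le α A hlE hΔ hp hρ.le) (by positivity) hexponent

theorem eventually_isSecureRate (hα : 0 < α) (hlB : 0 < lB) (hlE : 0 < lE) (hΔ : 0 < Δ)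
    (hc : c < α * Real.log (lE / lB)) :
    ∀ᶠ E : ℝ≥0 in 𝓝[>] 0, IsSecureRate α lB α lE Δ E (c * E) := by
  obtain ⟨A, hA, ρ, hρ, hρ1, hgain⟩ := exists_intensity_exponent_lt hα hlB hlE hΔ hc
  set x := 1 - chernoffPoisson ((α * A + lB) * Δ) (lB * Δ) ρ
  set y := chernoffPoisson ((α * A + lE) * Δ) (lE * Δ) (-ρ) - 1
  -- The factor `θ > 1` leaves room for the mean intensity `p * A` to stay strictly below `E`.
  obtain ⟨θ, hθ, hθ1⟩ : ∃ θ : ℝ≥0, ρ * (1 + θ * (Δ * (c * A))) < x - y ∧ 1 < θ := by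
    have hcont : Continuous fun θ : ℝ≥0 => ρ * (1 + θ * (Δ * (c * A)) : ℝ) := by fun_prop
    have hone : ρ * (1 + (1 : ℝ≥0) * (Δ * (c * A)) : ℝ) < x - y := by
      rw [NNReal.coe_one, one_mul]
      linarith
    have hnear := (hcont.tendsto 1).eventually (gt_mem_nhds hone)
    exact ((hnear.filter_mono nhdsWithin_le_nhds).and self_mem_nhdsWithin).exists (f := 𝓝[>] 1)
  have : 0 < θ := one_pos.trans hθ1
  have hduty : Tendsto (fun E : ℝ≥0 => ((E / (θ * A) : ℝ≥0) : ℝ)) (𝓝[>] 0) (𝓝[>] 0) := by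
    refine tendsto_nhdsWithin_iff.2 ⟨?_, ?_⟩
    · have hcont : Continuous fun E : ℝ≥0 => ((E / (θ * A) : ℝ≥0) : ℝ) := by fun_prop
      simpa using (hcont.tendsto 0).mono_left nhdsWithin_le_nhds
    · filter_upwards [self_mem_nhdsWithin] with E hE
      exact NNReal.coe_pos.2 (div_pos hE (by positivity))
  filter_upwards [hduty.eventually (eventually_onOff_exponent_lt hρ hθ),
    hduty.eventually (Ioo_mem_nhdsGT one_pos)] with E hE hp
  have hE_eq : E = θ * (E / (θ * A) * A) := by field_simp
  have hpA : E / (θ * A) * A < E :=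
    (lt_mul_of_one_lt_left (mul_pos (NNReal.coe_pos.1 hp.1) hA) hθ1).trans_eq hE_eq.symm
  have hrate : ρ * (Δ * (c * E : ℝ≥0)) = ρ * (θ * (Δ * (c * A)) * (E / (θ * A) : ℝ≥0)) := by
    have hE_eq' : (E : ℝ) = θ * ((E / (θ * A) : ℝ≥0) * A) := mod_cast hE_eq
    rw [NNReal.coe_mul, hE_eq']
    ring
  exact isSecureRate_of_onOff_exponent_lt hlB hlE hΔ hρ hρ1 hp.2 hpA (by rwa [hrate])

theorem eventually_lt_secrecyCapacity_div (hα : 0 < α) (hlB : 0 < lB) (hlE : 0 < lE)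
    (hΔ : 0 < Δ) {a : ℝ≥0∞} (ha : a < ENNReal.ofReal (α * Real.log (lE / lB))) :
    ∀ᶠ E : ℝ≥0 in 𝓝[>] 0, a < secrecyCapacity α lB α lE Δ E / E := by
  obtain ⟨c, hac, hc⟩ := ENNReal.lt_iff_exists_nnreal_btwn.1 ha
  have hc' : (c : ℝ) < α * Real.log (lE / lB) := by
    rwa [← ENNReal.ofReal_coe_nnreal, ENNReal.ofReal_lt_ofReal_iff_of_nonneg c.coe_nonneg] at hc
  filter_upwards [eventually_isSecureRate hα hlB hlE hΔ hc', self_mem_nhdsWithin] with E hE hE0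
  have hE0' : (E : ℝ≥0∞) ≠ 0 := ENNReal.coe_ne_zero.2 (ne_of_gt hE0)
  refine hac.trans_le ((ENNReal.le_div_iff_mul_le (.inl hE0') (.inl ENNReal.coe_ne_top)).2 ?_)
  rw [← ENNReal.coe_mul]
  exact le_iSup₂ (f := fun R (_ : IsSecureRate α lB α lE Δ E R) => (R : ℝ≥0∞)) (c * E) hE

end Gain

end PoissonWiretap

theorem theorem7 (αB lamB αE lamE Δ : ℝ≥0) (hαB : 0 < αB) (hlamB : 0 < lamB) (hlamE : 0 < lamE)
    (hΔ : 0 < Δ) (hα : αB = αE) (hdeg : lamB / αB ≤ lamE / αE) :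
    Tendsto (fun E : ℝ≥0 => PoissonWiretap.secrecyCapacity αB lamB αE lamE Δ E / (E : ℝ≥0∞))
      (𝓝[>] 0) (𝓝 (ENNReal.ofReal (αB * Real.log (lamE / lamB)))) := by
  subst hα
  have hlam : lamB ≤ lamE := (div_le_div_iff_of_pos_right hαB).1 hdeg
  refine tendsto_order.2 ⟨fun a ha => ?_, fun a ha => .of_forall fun E => ?_⟩
  · exact PoissonWiretap.eventually_lt_secrecyCapacity_div hαB hlamB hlamE hΔ ha
  · exact (ENNReal.div_le_of_le_mul
      (PoissonWiretap.secrecyCapacity_le hlamB hlam hΔ αB E)).trans_lt ha
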